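/- Let $n=n_1+n_2$, and let $S\subseteq\mathbb{Z}^n$ be nonempty with $\operatorname{conv}(S)\cap\mathbb{Z}^n=S$ and $$\operatorname{conv}(S)=\operatorname{conv}\{v^1,\dots,v^g\}+\operatorname{cone}\{r^1,\dots,r^h\}$$ for integer vectors $v^1,\dots,v^g,r^1,\dots,r^h\in\mathbb{Z}^n$; assume that the polyhedron $\operatorname{conv}(S)$ is pointed (contains no line). Let $e^1,\dots,e^{n_1}$ be the first $n_1$ unit vectors of $\mathbb{R}^n$ and $\mathcal{C}=\operatorname{cone}\{e^1,\dots,e^{n_1},r^1,\dots,r^h\}$. Assume that $\operatorname{cone}\{r^1,\dots,r^h\}$ has dimension $n_2$ and is contained in $\{\mathbf{0}\}\times\mathbb{R}^{n_2}$, and that $\operatorname{conv}(S)\subseteq\mathcal{C}$. Let $A\in\mathbb{Z}^{m\times n}$ have rows $a_1,\dots,a_m$ and let $b\in\mathbb{Z}^m$, with $Ax\ge\mathbf{0}$ for all $x\in\{e^1,\dots,e^{n_1},r^1,\dots,r^h\}$ and $b\ge\mathbf{0}$. Let $P^{\uparrow}=\{x\in\mathbb{R}^n: Ax\ge b\}$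 be nonempty, and put $$\Pi_{P^{\uparrow}}=\{(\lambda A,\lambda b)\in\mathbb{Z}^n\times\mathbb{R}:\ \lambda\in\mathbb{R}^m_+,\ \lambda b=\min\{\lambda Ax: x\in P^{\uparrow}\}\}.$$ For $(\alpha,\beta)\in\Pi_{P^{\uparrow}}$ let $\lceil\beta\rceil_{S,\alpha}=\min\{\alpha z: z\in S,\ \alpha z\ge\beta\}$. For $\Omega\subseteq\Pi_{P^{\uparrow}}$ let $P^{\uparrow}_{S,\Omega}=\bigcap_{(\alpha,\beta)\in\Omega}\{x\in\mathbb{R}^n:\alpha x\ge\lceil\beta\rceil_{S,\alpha}\}$, and let $P^{\uparrow}_S=P^{\uparrow}_{S,\Pi_{P^{\uparrow}}}$ be the $S$-Chvátal–Gomory closure of $P^{\uparrow}$. Let $B=\max_i b_i$, $D=\sum_{i=1}^m a_i\big(\sum_{k=1}^{n_1}e^k+\sum_{j=1}^h r^j\big)$, $M_1=2(mB+2D)$, and $M_i=(2mB\,M_1\cdots M_{i-1})^{i-1}M_1$ for $2\le i\le m-1$. Let $M=M_1\cdots M_{m-1}$ (so $M=1$ if $m=1$), let $M^*=mBM$, and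 $$\Pi=\{(\alpha,\beta)\in\Pi_{P^{\uparrow}}:\ \beta/(\alpha r^j)\le M^*\ \text{for all } j\in\{1,\dots,h\} \text{ with } \alpha r^j>0\}.$$ If $P^{\uparrow}\subseteq\mathcal{C}$ and the extreme points of $P^{\uparrow}$ are contained in $\operatorname{conv}(S)$, then $P^{\uparrow}_S=P^{\uparrow}_{S,\Pi}$, and in particular $P^{\uparrow}_S$ is a rational polyhedron. -/

import Mathlib

open scoped Pointwise Matrix

noncomputable section

namespace SCG

/-- An integer vector, viewed as a point of `ℝⁿ`. -/
def toReal {n : ℕ} (z : Fin n → ℤ) : Fin n → ℝ := fun i => (z i : ℝ)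

/-- The convex hull in `ℝⁿ` of a set of integer points. -/
def conv {n : ℕ} (S : Set (Fin n → ℤ)) : Set (Fin n → ℝ) :=
  convexHull ℝ (toReal '' S)

/-- Rational polyhedra: solution sets of finitely many linear inequalities with integer data. -/
def IsRationalPolyhedron {n : ℕ} (P : Set (Fin n → ℝ)) : Prop :=
  ∃ (m : ℕ) (A : Matrix (Fin m) (Fin n) ℤ) (b : Fin m → ℤ),
    P = {x | ∀ i, toReal (A i) ⬝ᵥ x ≤ (b i : ℝ)}

/-- A set is pointed if it contains no line. -/
def IsPointed {n : ℕ} (P : Set (Fin n → ℝ)) : Prop :=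
  ∀ x d : Fin n → ℝ, (∀ t : ℝ, x + t • d ∈ P) → d = 0

/-- The unit vectors `e¹, …, e^{n₁}` of `ℝ^{n₁} × {0} ⊆ ℝ^{n₁ + n₂}`. -/
def unitVec (n₁ n₂ : ℕ) (k : Fin n₁) : Fin (n₁ + n₂) → ℤ :=
  Pi.single (Fin.castAdd n₂ k) 1

/-- The cone generated by finitely many integer vectors (it always contains `0`). -/
def cone {n h : ℕ} (r : Fin h → Fin n → ℤ) : Set (Fin n → ℝ) :=
  PointedCone.hull ℝ (Set.range fun j => toReal (r j))

/-- The cone `𝒞 = cone {e¹, …, e^{n₁}, r¹, …, r^h}`. -/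
def bigCone {n₁ n₂ h : ℕ} (r : Fin h → Fin (n₁ + n₂) → ℤ) : Set (Fin (n₁ + n₂) → ℝ) :=
  PointedCone.hull ℝ
    ((Set.range fun k => toReal (unitVec n₁ n₂ k)) ∪ Set.range fun j => toReal (r j))

/-- The polyhedron `P↑ = {x : A x ≥ b}`. -/
def upPoly {m n : ℕ} (A : Matrix (Fin m) (Fin n) ℤ) (b : Fin m → ℤ) : Set (Fin n → ℝ) :=
  {x | ∀ i, (b i : ℝ) ≤ toReal (A i) ⬝ᵥ x}

/-- The set `Π_{P↑}` of all `(α, β) = (lam A, lam b)` with `lam ≥ 0`, `α` integral and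
`β = min {α x : x ∈ P↑}`, the minimum being attained. -/
def upPi {m n : ℕ} (A : Matrix (Fin m) (Fin n) ℤ) (b : Fin m → ℤ) :
    Set ((Fin n → ℤ) × ℝ) :=
  {p | ∃ lam : Fin m → ℝ, (∀ i, 0 ≤ lam i) ∧
    toReal p.1 = ∑ i, lam i • toReal (A i) ∧
    p.2 = ∑ i, lam i * (b i : ℝ) ∧
    IsLeast ((fun x => toReal p.1 ⬝ᵥ x) '' upPoly A b) p.2}

/-- `c = ⌈β⌉_{S,α}`, that is, `c = min {α z : z ∈ S, α z ≥ β}`. -/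
def IsSCeil {n : ℕ} (S : Set (Fin n → ℤ)) (α : Fin n → ℤ) (β c : ℝ) : Prop :=
  IsLeast {y : ℝ | β ≤ y ∧ ∃ z ∈ S, y = toReal α ⬝ᵥ toReal z} c

/-- The points that satisfy the `S`-Chvátal-Gomory cut `α x ≥ ⌈β⌉_{S,α}`; no point does if the
minimum `⌈β⌉_{S,α}` does not exist. -/
def sCut {n : ℕ} (S : Set (Fin n → ℤ)) (α : Fin n → ℤ) (β : ℝ) : Set (Fin n → ℝ) :=
  {x | ∃ c : ℝ, IsSCeil S α β c ∧ c ≤ toReal α ⬝ᵥ x}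

/-- `P_{S,Ω}`: the points that satisfy the `S`-CG cuts of all `(α, β) ∈ Ω`. -/
def closureOver {n : ℕ} (S : Set (Fin n → ℤ)) (Ω : Set ((Fin n → ℤ) × ℝ)) :
    Set (Fin n → ℝ) :=
  ⋂ p ∈ Ω, sCut S p.1 p.2

/-- The `S`-CG closure of `P↑`, `P↑_S = P_{S,Π_{P↑}}`. -/
def upClosure {m n : ℕ} (S : Set (Fin n → ℤ)) (A : Matrix (Fin m) (Fin n) ℤ) (b : Fin m → ℤ) :
    Set (Fin n → ℝ) :=
  closureOver S (upPi A b)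

/-- The ray-support of `α`: the indices `j` with `α r^j > 0`. -/
def raySupp {n h : ℕ} (r : Fin h → Fin n → ℤ) (α : Fin n → ℤ) : Set (Fin h) :=
  {j | 0 < α ⬝ᵥ r j}

/-- The members of `Π_{P↑}` all of whose intercepts `β / α r^j`, for `j` in the ray-support of
`α`, are at most `K`. -/
def upPiBounded {m n h : ℕ} (r : Fin h → Fin n → ℤ) (A : Matrix (Fin m) (Fin n) ℤ)
    (b : Fin m → ℤ) (K : ℝ) : Set ((Fin n → ℤ) × ℝ) :=
  {p | p ∈ upPi A b ∧ ∀ j ∈ raySupp r p.1, p.2 / ((p.1 ⬝ᵥ r j : ℤ) : ℝ) ≤ K}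

/-- `B = max_i b_i`. -/
def constB {m : ℕ} (b : Fin m → ℤ) : ℤ := ⨆ i, b i

/-- `D = ∑_i a_i (e¹ + ⋯ + e^{n₁} + r¹ + ⋯ + r^h)`. -/
def constD {m n₁ n₂ h : ℕ} (r : Fin h → Fin (n₁ + n₂) → ℤ)
    (A : Matrix (Fin m) (Fin (n₁ + n₂)) ℤ) : ℤ :=
  ∑ i, A i ⬝ᵥ (∑ k, unitVec n₁ n₂ k + ∑ j, r j)

/-- `constMi m B D i` is the constant `M_{i+1}`: the recursion reads `M_1 = 2 (m B + 2 D)` and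
`M_{i+1} = (2 m B M_1 ⋯ M_i) ^ i M_1`. -/
def constMi (m : ℕ) (B D : ℤ) (i : ℕ) : ℤ :=
  (2 * m * B * ∏ j : Fin i, constMi m B D j) ^ i * (2 * (m * B + 2 * D))
termination_by i
decreasing_by exact j.isLt

/-- `M = M_1 ⋯ M_{m-1}`, which is `1` if `m = 1`. -/
def constM (m : ℕ) (B D : ℤ) : ℤ := ∏ i ∈ Finset.range (m - 1), constMi m B D i

/-- `M* = m B M`. -/
def constMstar {m n₁ n₂ h : ℕ} (r : Fin h → Fin (n₁ + n₂) → ℤ)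
    (A : Matrix (Fin m) (Fin (n₁ + n₂)) ℤ) (b : Fin m → ℤ) : ℤ :=
  m * constB b * constM m (constB b) (constD r A)

end SCG

end

namespace SCG

/-! The theorem combines two finiteness arguments, both carried out in the space of multipliers
`lam`.

Bounded intercepts suffice (`exists_dominating_cut`, `closureOver_upPiBounded`). Suppose `α = lam A`
has `s = α r^j > 0` and `β / s > M*`. Then the largest multiplier is huge compared with `s`, while
every row with `a_i r^j > 0` has multiplier at most `s`. Scanning the sizes of the multipliers
yields a set `K` of rows orthogonal to `r^j` whose multipliers exceed all others by a prescribed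
factor (`exists_gap`). Dirichlet approximation gives positive integers `p` on `K` with `lam ≈ ρ p`
(`exists_integer_direction`). Subtracting `μ = s p` from `lam` leaves a cut that, together with the
rows of `A` in use, implies the original one. Let `z ∈ S` be a point where the reduced cut is tight.
If `p (A z - b) ≤ 0`, moving `z` along `r^j` lands exactly on the required value. Otherwise this
integer is at least `1` and the reduced cut has slack at least `s` (`half_sub_le_sum`), whereas
rounding in the original cut costs at most `s`. Each subtraction lowers the sum of the multipliers
by at least one, so the process stops at a bounded intercept.

Bounded intercepts give a polyhedron (`isRationalPolyhedron_closureOver`). With bounded intercepts,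
the minimum defining a cut is attained in a fixed finite set `F ⊆ S`. The signs of finitely many
integer forms in `lam` determine admissibility and the minimizing point `y`. On each sign cell the
cut reads `α (x - y) ≥ 0` with `y` fixed, which is linear in `lam`, so the finitely many integer
generators of the cell's closed cone describe all its cuts.

Pointedness and the condition on extreme points ensure that every `β` is attained on `conv S`, so
`S` has points on both sides of each supporting hyperplane. -/

theorem toReal_dotProduct {n : ℕ} (a z : Fin n → ℤ) :
    toReal a ⬝ᵥ toReal z = ((a ⬝ᵥ z : ℤ) : ℝ) := by
  simp [dotProduct, toReal]

theorem toReal_add {n : ℕ} (a z : Fin n → ℤ) : toReal (a + z) = toReal a + toReal z := by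
  ext; simp [toReal]

theorem toReal_sub {n : ℕ} (a z : Fin n → ℤ) : toReal (a - z) = toReal a - toReal z := by
  ext; simp [toReal]

theorem toReal_neg {n : ℕ} (a : Fin n → ℤ) : toReal (-a) = -toReal a := by
  ext; simp [toReal]

theorem toReal_smul {n : ℕ} (k : ℤ) (a : Fin n → ℤ) : toReal (k • a) = (k : ℝ) • toReal a := by
  ext; simp [toReal]

theorem toReal_sum {n : ℕ} {ι : Type*} (s : Finset ι) (f : ι → Fin n → ℤ) :
    toReal (∑ i ∈ s, f i) = ∑ i ∈ s, toReal (f i) := by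
  ext; simp [toReal]

/-! ### Integer generators of polyhedral cones and of sign cells. -/

/-- Membership in the cone generated by a finite set of integer vectors. -/
theorem mem_hull_toReal_image {m : ℕ} (G : Finset (Fin m → ℤ)) (y : Fin m → ℝ) :
    y ∈ PointedCone.hull ℝ (toReal '' (G : Set (Fin m → ℤ))) ↔
      ∃ c : (Fin m → ℤ) → ℝ, (∀ g, 0 ≤ c g) ∧ y = ∑ g ∈ G, c g • toReal g := by
  constructor
  · intro hy
    obtain ⟨c, hc⟩ := (Submodule.mem_span_image_finset_iff_exists_fun' _).1 hy
    exact ⟨fun g => (c g : ℝ), fun g => (c g).2, by rw [← hc]; rfl⟩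
  · rintro ⟨c, hc, rfl⟩
    refine Submodule.sum_mem _ fun g hg => ?_
    exact (PointedCone.hull ℝ _).smul_mem (hc g)
      (Submodule.subset_span ⟨g, hg, rfl⟩)

/-- Adding one homogeneous inequality to a finitely generated cone. -/
theorem mem_hull_of_nonneg {m : ℕ} (G : Finset (Fin m → ℤ)) (a : Fin m → ℤ) (y : Fin m → ℝ)
    (hy : y ∈ PointedCone.hull ℝ (toReal '' (G : Set (Fin m → ℤ)))) (hay : 0 ≤ toReal a ⬝ᵥ y)
    (C : PointedCone ℝ (Fin m → ℝ))
    (h1 : ∀ g ∈ G, 0 ≤ a ⬝ᵥ g → toReal g ∈ C)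
    (h2 : ∀ g ∈ G, ∀ k ∈ G, 0 < a ⬝ᵥ g → a ⬝ᵥ k < 0 →
      toReal ((a ⬝ᵥ g) • k + (-(a ⬝ᵥ k)) • g) ∈ C) : y ∈ C := by
  classical
  obtain ⟨c, hc, rfl⟩ := (mem_hull_toReal_image G y).1 hy
  have smem : ∀ (t : ℝ) (v : Fin m → ℝ), 0 ≤ t → v ∈ C → t • v ∈ C := fun t v ht hv =>
    C.smul_mem ht hv
  set p := ∑ g ∈ G with 0 ≤ a ⬝ᵥ g, c g * ((a ⬝ᵥ g : ℤ) : ℝ) with hp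
  set q := ∑ g ∈ G with ¬ 0 ≤ a ⬝ᵥ g, c g * -((a ⬝ᵥ g : ℤ) : ℝ) with hq
  have hpq : q ≤ p := by
    have : toReal a ⬝ᵥ ∑ g ∈ G, c g • toReal g = p - q := by
      rw [dotProduct_sum, hp, hq, ← Finset.sum_filter_add_sum_filter_not G (fun g => 0 ≤ a ⬝ᵥ g)]
      simp only [dotProduct_smul, toReal_dotProduct, smul_eq_mul, mul_neg, Finset.sum_neg_distrib]
      ring
    linarith
  have hq0 : ∀ g ∈ G.filter (fun g => ¬ 0 ≤ a ⬝ᵥ g), 0 ≤ c g * -((a ⬝ᵥ g : ℤ) : ℝ) := by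
    intro g hg
    have : (a ⬝ᵥ g) ≤ 0 := by have := (Finset.mem_filter.1 hg).2; omega
    have : ((a ⬝ᵥ g : ℤ) : ℝ) ≤ 0 := by exact_mod_cast this
    exact mul_nonneg (hc g) (by linarith)
  have hqn : 0 ≤ q := Finset.sum_nonneg hq0
  rw [← Finset.sum_filter_add_sum_filter_not G (fun g => 0 ≤ a ⬝ᵥ g)]
  set U := ∑ g ∈ G with 0 ≤ a ⬝ᵥ g, c g • toReal g with hU
  set V := ∑ g ∈ G with ¬ 0 ≤ a ⬝ᵥ g, c g • toReal g with hV
  have hUC : U ∈ C := Submodule.sum_mem _ fun g hg =>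
    smem _ _ (hc g) (h1 g (Finset.mem_filter.1 hg).1 (Finset.mem_filter.1 hg).2)
  rcases hqn.eq_or_lt with h0 | h0
  · have : V = 0 := by
      refine Finset.sum_eq_zero fun g hg => ?_
      have h3 := (Finset.sum_eq_zero_iff_of_nonneg hq0).1 (by rw [← hq]; exact h0.symm) g hg
      have h4 : ((a ⬝ᵥ g : ℤ) : ℝ) ≠ 0 := by
        have := (Finset.mem_filter.1 hg).2
        exact_mod_cast (by omega : a ⬝ᵥ g ≠ 0)
      have : c g = 0 := by
        rcases mul_eq_zero.1 h3 with h | h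
        · exact h
        · exact absurd (neg_eq_zero.1 h) h4
      rw [this, zero_smul]
    rw [this, add_zero]; exact hUC
  have hp0 : 0 < p := h0.trans_le hpq
  -- The weights `p` and `q` make the form `a` vanish on this vector. It expands into pairs of a
  -- nonnegative and a negative generator, each pair combined so that `a` vanishes on it. Since `q ≤
  -- p`, the original vector is recovered below by adding a nonnegative multiple of `U`.
  have key : p • V + q • U ∈ C := by
    have : p • V + q • U = ∑ g ∈ G with 0 ≤ a ⬝ᵥ g, ∑ k ∈ G with ¬ 0 ≤ a ⬝ᵥ k,
        (c g * c k) • toReal ((a ⬝ᵥ g) • k + (-(a ⬝ᵥ k)) • g) := by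
      simp only [toReal_add, toReal_smul, smul_add, Finset.sum_add_distrib]
      congr 1
      · rw [hp, hV, Finset.sum_smul_sum]
        refine Finset.sum_congr rfl fun g _ => Finset.sum_congr rfl fun k _ => ?_
        rw [smul_smul, smul_smul]; congr 1; ring
      · rw [hq, hU, Finset.sum_smul_sum, Finset.sum_comm]
        refine Finset.sum_congr rfl fun g _ => Finset.sum_congr rfl fun k _ => ?_
        rw [smul_smul, smul_smul]; congr 1; push_cast; ring
    rw [this]
    refine Submodule.sum_mem _ fun g hg => Submodule.sum_mem _ fun k hk => ?_
    obtain ⟨hgG, hg⟩ := Finset.mem_filter.1 hg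
    obtain ⟨hkG, hk⟩ := Finset.mem_filter.1 hk
    refine smem _ _ (mul_nonneg (hc g) (hc k)) ?_
    rcases hg.eq_or_lt with h | h
    · rw [← h, zero_smul, zero_add, toReal_smul]
      refine smem _ _ ?_ (h1 g hgG hg)
      exact_mod_cast (by omega : 0 ≤ -(a ⬝ᵥ k))
    · exact h2 g hgG k hkG h (not_le.1 hk)
  have : U + V = (1 - q / p) • U + p⁻¹ • (p • V + q • U) := by
    rw [smul_add, smul_smul, smul_smul, inv_mul_cancel₀ hp0.ne', one_smul, sub_smul, one_smul,
      div_eq_inv_mul]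
    abel
  rw [this]
  refine C.add_mem (smem _ _ ?_ hUC) (smem _ _ (by positivity) key)
  rw [sub_nonneg, div_le_one hp0]; exact hpq

/-- A polyhedral cone with integer data is generated by finitely many integer vectors. -/
theorem exists_int_generators {m : ℕ} (N : Finset (Fin m → ℤ)) :
    ∃ G : Finset (Fin m → ℤ), (∀ g ∈ G, ∀ a ∈ N, 0 ≤ a ⬝ᵥ g) ∧
      ∀ y : Fin m → ℝ, (∀ a ∈ N, 0 ≤ toReal a ⬝ᵥ y) →
        y ∈ PointedCone.hull ℝ (toReal '' (G : Set (Fin m → ℤ))) := by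
  classical
  induction N using Finset.induction_on with
  | empty =>
    refine ⟨Finset.univ.image (fun i : Fin m => Pi.single i 1) ∪
      Finset.univ.image (fun i : Fin m => -Pi.single i 1), by simp, fun y _ => ?_⟩
    set C := PointedCone.hull ℝ (toReal '' (((Finset.univ.image (fun i : Fin m => Pi.single i 1) ∪
      Finset.univ.image (fun i : Fin m => -Pi.single i 1) : Finset (Fin m → ℤ))) :
        Set (Fin m → ℤ)))
    have hy : y = ∑ i, (max (y i) 0 • toReal (Pi.single i 1) +
        max (-y i) 0 • toReal (-Pi.single i 1)) := by
      ext k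
      have : ∀ i, (max (y i) 0 • toReal (Pi.single i 1) +
        max (-y i) 0 • toReal (-Pi.single i 1)) k = if i = k then y i else 0 := by
        intro i
        by_cases h : i = k
        · subst h
          simp only [toReal_neg, Pi.add_apply, Pi.smul_apply, Pi.neg_apply, toReal, smul_eq_mul,
            Pi.single_eq_same, Int.cast_one, if_true]
          rcases le_total 0 (y i) with h | h
          · rw [max_eq_left h, max_eq_right (by linarith)]; ring
          · rw [max_eq_right h, max_eq_left (by linarith)]; ring
        · simp [toReal, h, Ne.symm h]
      simp [Finset.sum_apply, this]
    rw [hy]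
    refine Submodule.sum_mem _ fun i _ => C.add_mem ?_ ?_
    · exact C.smul_mem (le_max_right _ _)
        (Submodule.subset_span ⟨_, by simp, rfl⟩)
    · exact C.smul_mem (le_max_right _ _)
        (Submodule.subset_span ⟨_, by simp, rfl⟩)
  | insert a N ha ih =>
    obtain ⟨G, hG, hN⟩ := ih
    refine ⟨G.filter (fun g => 0 ≤ a ⬝ᵥ g) ∪
      ((G ×ˢ G).filter (fun x => 0 < a ⬝ᵥ x.1 ∧ a ⬝ᵥ x.2 < 0)).image
        (fun x => (a ⬝ᵥ x.1) • x.2 + (-(a ⬝ᵥ x.2)) • x.1), ?_, fun y hy => ?_⟩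
    · intro g hg d hd
      rcases Finset.mem_union.1 hg with hg | hg
      · obtain ⟨hg, hga⟩ := Finset.mem_filter.1 hg
        rcases Finset.mem_insert.1 hd with rfl | hd
        · exact hga
        · exact hG g hg d hd
      · obtain ⟨⟨u, v⟩, hx, rfl⟩ := Finset.mem_image.1 hg
        obtain ⟨hx, hu, hv⟩ := Finset.mem_filter.1 hx
        obtain ⟨huG, hvG⟩ := Finset.mem_product.1 hx
        simp only [dotProduct_add, dotProduct_smul, smul_eq_mul] at *
        rcases Finset.mem_insert.1 hd with rfl | hd
        · apply le_of_eq; ring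
        · have := hG u huG d hd
          have := hG v hvG d hd
          have : 0 ≤ -(a ⬝ᵥ v) := by omega
          positivity
    · refine mem_hull_of_nonneg G a y (hN y fun d hd => hy d (Finset.mem_insert_of_mem hd))
        (hy a (Finset.mem_insert_self _ _)) _ (fun g hg hga => ?_) (fun g hg k hk hga hka => ?_)
      · refine Submodule.subset_span ⟨g, ?_, rfl⟩
        exact_mod_cast Finset.mem_union_left _ (Finset.mem_filter.2 ⟨hg, hga⟩)
      · refine Submodule.subset_span ⟨_, ?_, rfl⟩
        refine Finset.mem_coe.2 (Finset.mem_union_right _ (Finset.mem_image.2 ⟨(g, k), ?_, rfl⟩))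
        exact Finset.mem_filter.2 ⟨Finset.mem_product.2 ⟨hg, hk⟩, hga, hka⟩

/-- The vectors at which finitely many integer linear forms have prescribed signs lie in a cone
with finitely many integer generators, each of which is a limit direction of such vectors. -/
theorem exists_sign_generators {m : ℕ} (L : Finset (Fin m → ℤ)) (y : Fin m → ℝ) :
    ∃ (G : Finset (Fin m → ℤ)) (g₀ : Fin m → ℤ),
      (∀ g ∈ G, ∀ N : ℕ, ∀ a ∈ L,
        SignType.sign (toReal a ⬝ᵥ toReal ((N : ℤ) • g + g₀)) = SignType.sign (toReal a ⬝ᵥ y)) ∧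
      ∀ y' : Fin m → ℝ,
        (∀ a ∈ L, SignType.sign (toReal a ⬝ᵥ y') = SignType.sign (toReal a ⬝ᵥ y)) →
          y' ∈ PointedCone.hull ℝ (toReal '' (G : Set (Fin m → ℤ))) := by
  classical
  set N := L.filter (fun a => 0 ≤ toReal a ⬝ᵥ y) ∪
    (L.filter (fun a => toReal a ⬝ᵥ y ≤ 0)).image (fun a => -a) with hN
  obtain ⟨G, hG, hGy⟩ := exists_int_generators N
  have hmem : ∀ y' : Fin m → ℝ,
      (∀ a ∈ L, SignType.sign (toReal a ⬝ᵥ y') = SignType.sign (toReal a ⬝ᵥ y)) →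
      ∀ a ∈ N, 0 ≤ toReal a ⬝ᵥ y' := by
    intro y' hy' a ha
    rcases Finset.mem_union.1 ha with ha | ha
    · obtain ⟨haL, ha⟩ := Finset.mem_filter.1 ha
      have := hy' a haL
      rw [← sign_nonneg_iff] at ha ⊢
      rwa [this]
    · obtain ⟨d, hd, rfl⟩ := Finset.mem_image.1 ha
      obtain ⟨hdL, hd⟩ := Finset.mem_filter.1 hd
      have := hy' d hdL
      rw [← sign_nonpos_iff, ← this, sign_nonpos_iff] at hd
      rw [toReal_neg, neg_dotProduct]; linarith
  -- a form that is positive at a point of the cone is positive at some generator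
  have hpos : ∀ a : Fin m → ℤ, (∀ g ∈ G, 0 ≤ a ⬝ᵥ g) → 0 < toReal a ⬝ᵥ y →
      0 < a ⬝ᵥ ∑ g ∈ G, g := by
    intro a ha hay
    obtain ⟨c, hc, hyc⟩ := (mem_hull_toReal_image G y).1 (hGy y (hmem y fun _ _ => rfl))
    rw [dotProduct_sum]
    refine (Finset.sum_nonneg ha).lt_of_ne fun h => ?_
    have h0 := (Finset.sum_eq_zero_iff_of_nonneg ha).1 h.symm
    rw [hyc, dotProduct_sum] at hay
    refine hay.ne' (Finset.sum_eq_zero fun g hg => ?_)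
    rw [dotProduct_smul, toReal_dotProduct, h0 g hg]; simp
  -- The sum of all generators satisfies every strict inequality of the cell strictly, so adding it
  -- moves any multiple of a generator into the cell itself.
  refine ⟨G, ∑ g ∈ G, g, fun g hg k a ha => ?_, fun y' hy' => hGy y' (hmem y' hy')⟩
  rw [toReal_dotProduct, dotProduct_add, dotProduct_smul, smul_eq_mul]
  rcases lt_trichotomy (toReal a ⬝ᵥ y) 0 with h | h | h
  · have h1 : ∀ g ∈ G, 0 ≤ (-a) ⬝ᵥ g := fun g hg => hG g hg _ (Finset.mem_union_right _
      (Finset.mem_image.2 ⟨a, Finset.mem_filter.2 ⟨ha, h.le⟩, rfl⟩))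
    have h2 := hpos (-a) h1 (by rw [toReal_neg, neg_dotProduct]; linarith)
    have h3 := h1 g hg
    rw [neg_dotProduct] at h2 h3
    rw [sign_neg h]
    refine sign_neg ?_
    have : 0 ≤ (k : ℤ) * -(a ⬝ᵥ g) := by positivity
    exact_mod_cast (by linarith)
  · have h1 : ∀ g ∈ G, a ⬝ᵥ g = 0 := fun g hg => by
      have h1 := hG g hg (-a) (Finset.mem_union_right _
        (Finset.mem_image.2 ⟨a, Finset.mem_filter.2 ⟨ha, h.le⟩, rfl⟩))
      have h2 := hG g hg a (Finset.mem_union_left _ (Finset.mem_filter.2 ⟨ha, h.ge⟩))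
      rw [neg_dotProduct] at h1
      omega
    rw [h1 g hg, dotProduct_sum, Finset.sum_eq_zero h1, h]
    simp
  · have h1 : ∀ g ∈ G, 0 ≤ a ⬝ᵥ g := fun g hg => hG g hg _ (Finset.mem_union_left _
      (Finset.mem_filter.2 ⟨ha, h.le⟩))
    have h2 := hpos a h1 h
    have h3 := h1 g hg
    rw [sign_pos h]
    refine sign_pos ?_
    have : 0 ≤ (k : ℤ) * (a ⬝ᵥ g) := by positivity
    exact_mod_cast (by linarith)

/-! ### Rational polyhedra as finite systems of inequalities. -/

theorem isRationalPolyhedron_setOf {n : ℕ} (G : Finset ((Fin n → ℤ) × ℤ)) :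
    IsRationalPolyhedron {x : Fin n → ℝ | ∀ p ∈ G, toReal p.1 ⬝ᵥ x ≤ (p.2 : ℝ)} := by
  refine ⟨G.card, fun i => (G.equivFin.symm i).1.1, fun i => (G.equivFin.symm i).1.2, ?_⟩
  ext x
  constructor
  · exact fun hx i => hx _ (G.equivFin.symm i).2
  · intro hx p hp
    have := hx (G.equivFin ⟨p, hp⟩)
    simpa using this

theorem IsRationalPolyhedron.exists_finset {n : ℕ} {P : Set (Fin n → ℝ)}
    (hP : IsRationalPolyhedron P) : ∃ G : Finset ((Fin n → ℤ) × ℤ),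
      P = {x : Fin n → ℝ | ∀ p ∈ G, toReal p.1 ⬝ᵥ x ≤ (p.2 : ℝ)} := by
  classical
  obtain ⟨m, A, b, rfl⟩ := hP
  exact ⟨Finset.univ.image fun i => (A i, b i), by simp⟩

theorem IsRationalPolyhedron.biInter {n : ℕ} {ι : Type*} {s : Set ι} (hs : s.Finite)
    {X : ι → Set (Fin n → ℝ)} (hX : ∀ i ∈ s, IsRationalPolyhedron (X i)) :
    IsRationalPolyhedron (⋂ i ∈ s, X i) := by
  classical
  have : ∀ i, ∃ G : Finset ((Fin n → ℤ) × ℤ), i ∈ s →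
      X i = {x : Fin n → ℝ | ∀ p ∈ G, toReal p.1 ⬝ᵥ x ≤ (p.2 : ℝ)} := by
    intro i
    by_cases hi : i ∈ s
    · exact (hX i hi).exists_finset.imp fun _ h _ => h
    · exact ⟨∅, fun h => absurd h hi⟩
  choose G hG using this
  convert isRationalPolyhedron_setOf (hs.toFinset.biUnion G) using 1
  ext x
  simp only [Set.mem_iInter, Finset.mem_biUnion, Set.Finite.mem_toFinset, Set.mem_ofPred_eq,
    forall_exists_index, and_imp]
  constructor
  · intro h p i hi hp
    have := h i hi
    rw [hG i hi] at this
    exact this p hp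
  · intro h i hi
    rw [hG i hi]
    exact fun p hp => h p i hi hp

/-! ### The generated cones and the integer points of `conv S`. -/

theorem mem_cone_iff {n h : ℕ} (r : Fin h → Fin n → ℤ) (x : Fin n → ℝ) :
    x ∈ cone r ↔ ∃ c : Fin h → ℝ, (∀ j, 0 ≤ c j) ∧ x = ∑ j, c j • toReal (r j) := by
  constructor
  · intro hx
    obtain ⟨c, hc⟩ := (Submodule.mem_span_range_iff_exists_fun _).1 hx
    exact ⟨fun j => (c j : ℝ), fun j => (c j).2, by rw [← hc]; rfl⟩
  · rintro ⟨c, hc, rfl⟩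
    refine Submodule.sum_mem _ fun j _ => PointedCone.smul_mem _ (hc j)
      (Submodule.subset_span ⟨j, rfl⟩)

theorem mem_bigCone_iff {n₁ n₂ h : ℕ} (r : Fin h → Fin (n₁ + n₂) → ℤ) (x : Fin (n₁ + n₂) → ℝ) :
    x ∈ bigCone r ↔ ∃ c : Fin n₁ → ℝ, (∀ k, 0 ≤ c k) ∧ ∃ y ∈ cone r,
      x = ∑ k, c k • toReal (unitVec n₁ n₂ k) + y := by
  rw [bigCone, SetLike.mem_coe, PointedCone.hull, Submodule.span_union, Submodule.mem_sup]
  constructor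
  · rintro ⟨u, hu, y, hy, rfl⟩
    obtain ⟨c, hc, rfl⟩ := (mem_cone_iff _ _).1 hu
    exact ⟨c, hc, y, hy, rfl⟩
  · rintro ⟨c, hc, y, hy, rfl⟩
    exact ⟨_, (mem_cone_iff _ _).2 ⟨c, hc, rfl⟩, y, hy, rfl⟩

theorem cone_add_mem {n h : ℕ} {r : Fin h → Fin n → ℤ} {x y : Fin n → ℝ}
    (hx : x ∈ cone r) (hy : y ∈ cone r) : x + y ∈ cone r :=
  (PointedCone.hull ℝ (Set.range fun j => toReal (r j))).add_mem hx hy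

theorem dotProduct_nonneg_of_mem_cone {n h : ℕ} {r : Fin h → Fin n → ℤ} {a : Fin n → ℤ}
    (ha : ∀ j, 0 ≤ a ⬝ᵥ r j) {x : Fin n → ℝ} (hx : x ∈ cone r) : 0 ≤ toReal a ⬝ᵥ x := by
  obtain ⟨c, hc, rfl⟩ := (mem_cone_iff _ _).1 hx
  rw [dotProduct_sum]
  refine Finset.sum_nonneg fun j _ => ?_
  rw [dotProduct_smul, toReal_dotProduct]
  exact mul_nonneg (hc j) (by exact_mod_cast ha j)

theorem dotProduct_nonneg_of_mem_bigCone {n₁ n₂ h : ℕ} {r : Fin h → Fin (n₁ + n₂) → ℤ}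
    {a : Fin (n₁ + n₂) → ℤ} (hae : ∀ k, 0 ≤ a ⬝ᵥ unitVec n₁ n₂ k) (har : ∀ j, 0 ≤ a ⬝ᵥ r j)
    {x : Fin (n₁ + n₂) → ℝ} (hx : x ∈ bigCone r) : 0 ≤ toReal a ⬝ᵥ x := by
  obtain ⟨c, hc, y, hy, rfl⟩ := (mem_bigCone_iff _ _).1 hx
  rw [dotProduct_add]
  exact add_nonneg (dotProduct_nonneg_of_mem_cone hae ((mem_cone_iff _ _).2 ⟨c, hc, rfl⟩))
    (dotProduct_nonneg_of_mem_cone har hy)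

section Generators

variable {n g h : ℕ} {S : Set (Fin n → ℤ)} {v : Fin g → Fin n → ℤ} {r : Fin h → Fin n → ℤ}

theorem conv_add_cone_mem (hSgen : conv S = conv (Set.range v) + cone r) {x y : Fin n → ℝ}
    (hx : x ∈ conv S) (hy : y ∈ cone r) : x + y ∈ conv S := by
  rw [hSgen] at hx ⊢
  obtain ⟨u, hu, w, hw, rfl⟩ := hx
  exact ⟨u, hu, w + y, cone_add_mem hw hy, (add_assoc _ _ _).symm⟩

theorem add_rays_mem (hSint : ∀ z : Fin n → ℤ, toReal z ∈ conv S → z ∈ S)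
    (hSgen : conv S = conv (Set.range v) + cone r) {z : Fin n → ℤ} (hz : z ∈ S)
    (k : Fin h → ℕ) : z + ∑ j, (k j : ℤ) • r j ∈ S := by
  refine hSint _ ?_
  rw [toReal_add]
  refine conv_add_cone_mem hSgen (subset_convexHull _ _ ⟨z, hz, rfl⟩) ?_
  refine (mem_cone_iff _ _).2 ⟨fun j => (k j : ℝ), fun j => by positivity, ?_⟩
  simp only [toReal_sum, toReal_smul, Int.cast_natCast]

theorem finite_toReal_preimage {K : Set (Fin n → ℝ)} (hK : Bornology.IsBounded K) :
    {z : Fin n → ℤ | toReal z ∈ K}.Finite := by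
  obtain ⟨R, hR⟩ := hK.exists_norm_le
  refine (Set.finite_Icc (fun _ => -⌈R⌉ : Fin n → ℤ) (fun _ => ⌈R⌉)).subset fun z hz => ?_
  have h1 : ∀ i, |(z i : ℝ)| ≤ R := fun i => (norm_le_pi_norm (toReal z) i).trans (hR _ hz)
  have h2 : ∀ i, |z i| ≤ ⌈R⌉ := fun i => by
    have := (h1 i).trans (Int.le_ceil R)
    exact_mod_cast this
  exact ⟨fun i => (abs_le.1 (h2 i)).1, fun i => (abs_le.1 (h2 i)).2⟩

/-- The integer points are finitely generated as a set with an action of the monoid of rays. -/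
theorem exists_finite_base (hSint : ∀ z : Fin n → ℤ, toReal z ∈ conv S → z ∈ S)
    (hSgen : conv S = conv (Set.range v) + cone r) :
    ∃ F : Finset (Fin n → ℤ), (∀ f ∈ F, f ∈ S) ∧
      ∀ z ∈ S, ∃ f ∈ F, ∃ k : Fin h → ℕ, z = f + ∑ j, (k j : ℤ) • r j := by
  classical
  -- Rounding down the ray coefficients leaves an integer point in this bounded set, which contains
  -- only finitely many.
  set K : Set (Fin n → ℝ) := conv (Set.range v) +
    (fun t : Fin h → ℝ => ∑ j, t j • toReal (r j)) '' Set.Icc 0 1 with hK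
  have hKb : Bornology.IsBounded K := by
    refine Bornology.IsBounded.add ?_ ?_
    · exact isBounded_convexHull.2 ((Set.finite_range v).image _).isBounded
    · exact (isCompact_Icc.image (by fun_prop)).isBounded
  have hfin : {z : Fin n → ℤ | toReal z ∈ K}.Finite := finite_toReal_preimage hKb
  refine ⟨hfin.toFinset, fun f hf => ?_, fun z hz => ?_⟩
  · obtain ⟨u, hu, w, ⟨t, ht, rfl⟩, hf⟩ := hfin.mem_toFinset.1 hf
    refine hSint f ?_
    rw [← hf, hSgen]
    exact ⟨u, hu, _, (mem_cone_iff _ _).2 ⟨t, fun j => ht.1 j, rfl⟩, rfl⟩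
  · have : toReal z ∈ conv S := subset_convexHull _ _ ⟨z, hz, rfl⟩
    rw [hSgen] at this
    obtain ⟨u, hu, w, hw, hz⟩ := this
    obtain ⟨c, hc, rfl⟩ := (mem_cone_iff _ _).1 hw
    refine ⟨z - ∑ j, ((⌊c j⌋₊ : ℕ) : ℤ) • r j, hfin.mem_toFinset.2 ?_, fun j => ⌊c j⌋₊, by simp⟩
    refine ⟨u, hu, ∑ j, (c j - ⌊c j⌋₊) • toReal (r j), ⟨fun j => c j - ⌊c j⌋₊, ⟨fun j => ?_,
      fun j => ?_⟩, rfl⟩, ?_⟩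
    · exact sub_nonneg.2 (Nat.floor_le (hc j))
    · have := Nat.lt_floor_add_one (c j)
      simp only [Pi.one_apply]; linarith
    · rw [toReal_sub, ← hz, toReal_sum]
      simp only [toReal_smul, sub_smul, Finset.sum_sub_distrib, Int.cast_natCast]
      abel

end Generators

/-! ### Optimal extreme points and existence of the rounded right-hand side. -/

/-- This says that `P↑` contains no line. The first `n₁` coordinates are nonnegative on `𝒞`, so they
are constant along a line in `P↑`. Removing them leaves a line in the cone of the rays, and
translating it by a point of `S` puts a line into the pointed set `conv S`. -/
theorem eq_zero_of_forall_dotProduct_eq_zero {n₁ n₂ g h m : ℕ} {S : Set (Fin (n₁ + n₂) → ℤ)}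
    (hS : S.Nonempty) (hSpt : IsPointed (conv S))
    {v : Fin g → Fin (n₁ + n₂) → ℤ} {r : Fin h → Fin (n₁ + n₂) → ℤ}
    (hSgen : conv S = conv (Set.range v) + cone r)
    (hr0 : ∀ x ∈ cone r, ∀ k : Fin n₁, x (Fin.castAdd n₂ k) = 0)
    {A : Matrix (Fin m) (Fin (n₁ + n₂)) ℤ} {b : Fin m → ℤ}
    (hP : (upPoly A b).Nonempty) (hPC : upPoly A b ⊆ bigCone r)
    {x : Fin (n₁ + n₂) → ℝ} (hx : ∀ i, toReal (A i) ⬝ᵥ x = 0) : x = 0 := by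
  obtain ⟨x₀, hx₀⟩ := hP
  obtain ⟨z, hz⟩ := hS
  have hline : ∀ t : ℝ, x₀ + t • x ∈ bigCone r := fun t => hPC fun i => by
    rw [dotProduct_add, dotProduct_smul, hx i]; simpa using hx₀ i
  have hdec : ∀ t : ℝ, ∃ c : Fin n₁ → ℝ, (∀ k, 0 ≤ c k) ∧ ∃ y ∈ cone r,
      x₀ + t • x = ∑ k, c k • toReal (unitVec n₁ n₂ k) + y ∧
      ∀ k, c k = x₀ (Fin.castAdd n₂ k) + t * x (Fin.castAdd n₂ k) := fun t => by
    obtain ⟨c, hc, y, hy, h1⟩ := (mem_bigCone_iff _ _).1 (hline t)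
    refine ⟨c, hc, y, hy, h1, fun k => ?_⟩
    have := congrFun h1 (Fin.castAdd n₂ k)
    simp only [Pi.add_apply, Pi.smul_apply, smul_eq_mul, Finset.sum_apply, hr0 y hy k,
      add_zero] at this
    rw [this, Finset.sum_eq_single k]
    · simp [toReal, unitVec]
    · intro l _ hl
      have : Fin.castAdd n₂ k ≠ Fin.castAdd n₂ l := fun h => hl (Fin.castAdd_injective _ _ h).symm
      simp [toReal, unitVec, this]
    · simp
  have hx1 : ∀ k : Fin n₁, x (Fin.castAdd n₂ k) = 0 := fun k => by
    by_contra hne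
    obtain ⟨c, hc, y, hy, h1, h2⟩ :=
      hdec (-(x₀ (Fin.castAdd n₂ k) + 1) / x (Fin.castAdd n₂ k))
    have h3 := h2 k
    rw [div_mul_cancel₀ _ hne] at h3
    linarith [hc k]
  refine hSpt (toReal z + (x₀ - ∑ k, x₀ (Fin.castAdd n₂ k) • toReal (unitVec n₁ n₂ k))) x
    fun t => ?_
  obtain ⟨c, hc, y, hy, h1, h2⟩ := hdec t
  have : toReal z + (x₀ - ∑ k, x₀ (Fin.castAdd n₂ k) • toReal (unitVec n₁ n₂ k)) + t • x =
      toReal z + y := by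
    have h3 : ∑ k, x₀ (Fin.castAdd n₂ k) • toReal (unitVec n₁ n₂ k) =
        ∑ k, c k • toReal (unitVec n₁ n₂ k) :=
      Finset.sum_congr rfl fun k _ => by rw [h2 k, hx1 k, mul_zero, add_zero]
    rw [h3, add_assoc, sub_add_eq_add_sub, h1]; abel
  rw [this]
  exact conv_add_cone_mem hSgen (subset_convexHull _ _ ⟨z, hz, rfl⟩) hy

theorem le_sum_dotProduct {n m : ℕ} {A : Matrix (Fin m) (Fin n) ℤ} {b : Fin m → ℤ}
    (hb : ∀ i, 0 ≤ b i) {x : Fin n → ℝ} (hx : x ∈ upPoly A b) (i : Fin m) :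
    toReal (A i) ⬝ᵥ x ≤ (∑ i, toReal (A i)) ⬝ᵥ x := by
  rw [sum_dotProduct]
  refine Finset.single_le_sum (f := fun i => toReal (A i) ⬝ᵥ x) (fun k _ => ?_)
    (Finset.mem_univ i)
  exact le_trans (by exact_mod_cast hb k) (hx k)

/-- A linear form that attains its minimum over a line-free polyhedron attains it at an extreme
point. -/
theorem exists_extreme_minimizer {n m : ℕ} {A : Matrix (Fin m) (Fin n) ℤ} {b : Fin m → ℤ}
    (hb : ∀ i, 0 ≤ b i) (hA : ∀ x : Fin n → ℝ, (∀ i, toReal (A i) ⬝ᵥ x = 0) → x = 0)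
    {a : Fin n → ℝ} {β : ℝ} (hβ : IsLeast ((fun x => a ⬝ᵥ x) '' upPoly A b) β) :
    ∃ x ∈ (upPoly A b).extremePoints ℝ, a ⬝ᵥ x = β := by
  obtain ⟨⟨x₁, hx₁, hax₁⟩, hmin⟩ := hβ
  set l : Fin n → ℝ := ∑ i, toReal (A i) with hl
  have hcont : ∀ c : Fin n → ℝ, Continuous fun x : Fin n → ℝ => c ⬝ᵥ x := fun c => by
    unfold dotProduct; fun_prop
  set f : (Fin n → ℝ) →ₗ[ℝ] (Fin m → ℝ) :=
    { toFun := fun x i => toReal (A i) ⬝ᵥ x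
      map_add' := fun x y => by ext i; simp [dotProduct_add]
      map_smul' := fun c x => by ext i; simp [dotProduct_smul] } with hf
  have hfker : LinearMap.ker f = ⊥ := by
    rw [LinearMap.ker_eq_bot']
    exact fun x hx => hA x fun i => congrFun hx i
  have hfe : Topology.IsClosedEmbedding f :=
    LinearMap.isClosedEmbedding_of_injective hfker
  have hPcl : IsClosed (upPoly A b) := by
    have : upPoly A b = ⋂ i, {x | (b i : ℝ) ≤ toReal (A i) ⬝ᵥ x} := by ext; simp [upPoly]
    rw [this]
    exact isClosed_iInter fun i => isClosed_le continuous_const (hcont _)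
  -- The optimal face may be unbounded, so it is truncated by the sum `l` of the rows. This confines
  -- `A x` to a box, and `x ↦ A x` is a closed embedding.
  have hFc : IsCompact {x | x ∈ upPoly A b ∧ a ⬝ᵥ x = β ∧ l ⬝ᵥ x ≤ l ⬝ᵥ x₁} := by
    refine IsCompact.of_isClosed_subset
      (hfe.isCompact_preimage (isCompact_Icc (a := (0 : Fin m → ℝ)) (b := fun _ => l ⬝ᵥ x₁)))
      ?_ ?_
    · exact hPcl.inter ((isClosed_eq (hcont _) continuous_const).inter
        (isClosed_le (hcont _) continuous_const))
    · rintro x ⟨hx, -, hxl⟩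
      refine ⟨fun i => le_trans (Int.cast_nonneg (hb i)) (hx i), fun i => ?_⟩
      exact (le_sum_dotProduct hb hx i).trans hxl
  obtain ⟨x₂, hx₂, hx₂min⟩ := hFc.exists_isMinOn ⟨x₁, hx₁, hax₁, le_rfl⟩ (hcont l).continuousOn
  have hl2 : ∀ x ∈ upPoly A b, a ⬝ᵥ x = β → l ⬝ᵥ x₂ ≤ l ⬝ᵥ x := fun x hx hax => by
    rcases le_total (l ⬝ᵥ x) (l ⬝ᵥ x₁) with h | h
    · exact hx₂min ⟨hx, hax, h⟩
    · exact hx₂.2.2.trans h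
  -- Minimizing `l` over the optimal face gives a compact face of a face. An extreme point of it is
  -- therefore extreme in the whole polyhedron.
  have hEc : IsCompact {x | x ∈ upPoly A b ∧ a ⬝ᵥ x = β ∧ l ⬝ᵥ x = l ⬝ᵥ x₂} := by
    refine hFc.of_isClosed_subset ?_ ?_
    · exact hPcl.inter ((isClosed_eq (hcont _) continuous_const).inter
        (isClosed_eq (hcont _) continuous_const))
    · rintro x ⟨hx, hax, hxl⟩
      exact ⟨hx, hax, hxl.trans_le hx₂.2.2⟩
  obtain ⟨x₃, hx₃⟩ := hEc.extremePoints_nonempty ⟨x₂, hx₂.1, hx₂.2.1, rfl⟩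
  have hx₃E := hx₃.1
  have hseg : ∀ (c : Fin n → ℝ) (x y : Fin n → ℝ) (γ : ℝ), x₃ ∈ openSegment ℝ x y →
      c ⬝ᵥ x₃ = γ → γ ≤ c ⬝ᵥ x → γ ≤ c ⬝ᵥ y → c ⬝ᵥ x = γ ∧ c ⬝ᵥ y = γ := by
    rintro c x y γ ⟨s, t, hs, ht, hst, h3⟩ hγ hx hy
    rw [← h3, dotProduct_add, dotProduct_smul, dotProduct_smul, smul_eq_mul, smul_eq_mul] at hγ
    have h1 : s * (c ⬝ᵥ x - γ) + t * (c ⬝ᵥ y - γ) = 0 := by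
      linear_combination hγ - γ * hst
    have h2 := mul_nonneg hs.le (sub_nonneg.2 hx)
    have h4 := mul_nonneg ht.le (sub_nonneg.2 hy)
    have h5 : s * (c ⬝ᵥ x - γ) = 0 := by linarith
    have h6 : t * (c ⬝ᵥ y - γ) = 0 := by linarith
    exact ⟨by linarith [(mul_eq_zero.1 h5).resolve_left hs.ne'],
      by linarith [(mul_eq_zero.1 h6).resolve_left ht.ne']⟩
  refine ⟨x₃, ⟨hx₃E.1, fun x hx y hy hxy => ?_⟩, hx₃E.2.1⟩
  obtain ⟨h1, h2⟩ := hseg a x y β hxy hx₃E.2.1 (hmin ⟨x, hx, rfl⟩) (hmin ⟨y, hy, rfl⟩)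
  obtain ⟨h3, h4⟩ := hseg l x y _ hxy hx₃E.2.2 (hl2 x hx h1) (hl2 y hy h2)
  exact hx₃.2 ⟨hx, h1, h3⟩ ⟨hy, h2, h4⟩ hxy

theorem exists_le_of_mem_conv {n : ℕ} {S : Set (Fin n → ℤ)} {a x : Fin n → ℝ}
    (hx : x ∈ conv S) : ∃ z ∈ S, a ⬝ᵥ toReal z ≤ a ⬝ᵥ x := by
  by_contra! hne
  have hlin : IsLinearMap ℝ fun y : Fin n → ℝ => a ⬝ᵥ y :=
    ⟨fun y z => dotProduct_add _ _ _, fun c y => dotProduct_smul _ _ _⟩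
  have : conv S ⊆ {y | a ⬝ᵥ x < a ⬝ᵥ y} :=
    convexHull_min (by rintro _ ⟨z, hz, rfl⟩; exact hne z hz) (convex_halfSpace_gt hlin _)
  exact lt_irrefl (a ⬝ᵥ x) (this hx)

theorem exists_ge_of_mem_conv {n : ℕ} {S : Set (Fin n → ℤ)} {a x : Fin n → ℝ}
    (hx : x ∈ conv S) : ∃ z ∈ S, a ⬝ᵥ x ≤ a ⬝ᵥ toReal z := by
  obtain ⟨z, hz, h⟩ := exists_le_of_mem_conv (a := -a) hx
  exact ⟨z, hz, by simpa using h⟩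

/-- The competing values are integers bounded below by `β`, so one feasible point suffices. -/
theorem exists_isSCeil {n : ℕ} {S : Set (Fin n → ℤ)} {α : Fin n → ℤ} {β : ℝ} {z : Fin n → ℤ}
    (hz : z ∈ S) (hβ : β ≤ toReal α ⬝ᵥ toReal z) : ∃ c, IsSCeil S α β c := by
  obtain ⟨k, ⟨hk, y, hy, hyk⟩, hmin⟩ := Int.exists_least_of_bdd
    (P := fun k => β ≤ (k : ℝ) ∧ ∃ z ∈ S, α ⬝ᵥ z = k)
    ⟨⌊β⌋, fun k hk => by exact_mod_cast (Int.floor_le β).trans hk.1⟩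
    ⟨α ⬝ᵥ z, by rwa [← toReal_dotProduct], z, hz, rfl⟩
  refine ⟨k, ⟨hk, y, hy, by rw [toReal_dotProduct, hyk]⟩, ?_⟩
  rintro _ ⟨hw, w, hwS, rfl⟩
  rw [toReal_dotProduct] at hw ⊢
  exact_mod_cast hmin _ ⟨hw, w, hwS, rfl⟩

/-! ### Diophantine approximation of the multipliers. -/

/-- Dirichlet's theorem on simultaneous approximation. -/
theorem exists_simultaneous_approx {ι : Type*} [DecidableEq ι] (K : Finset ι) (x : ι → ℝ) {Q : ℕ}
    (hQ : 0 < Q) : ∃ q : ℕ, 1 ≤ q ∧ q ≤ Q ^ K.card ∧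
      ∃ p : ι → ℤ, ∀ i ∈ K, |(q : ℝ) * x i - p i| ≤ 1 / Q := by
  have hQ' : (0 : ℝ) < Q := by exact_mod_cast hQ
  -- Pigeonhole: `Q ^ |K| + 1` multiples fall into `Q ^ |K|` boxes of side `1 / Q`.
  set F : ℕ → (K → ℕ) := fun t i => ⌊(Q : ℝ) * Int.fract ((t : ℝ) * x i)⌋₊ with hF
  have hmaps : Set.MapsTo F (Finset.range (Q ^ K.card + 1))
      (Fintype.piFinset fun _ : K => Finset.range Q : Finset (K → ℕ)) := by
    intro t _
    refine Finset.mem_coe.2 (Fintype.mem_piFinset.2 fun i => Finset.mem_range.2 ?_)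
    refine (Nat.floor_lt (mul_nonneg hQ'.le (Int.fract_nonneg _))).2 ?_
    exact mul_lt_of_lt_one_right hQ' (Int.fract_lt_one _)
  obtain ⟨s, hs, t, ht, hst, hFst⟩ := Finset.exists_ne_map_eq_of_card_lt_of_maps_to
    (by simp [Fintype.card_piFinset]) hmaps
  have key : ∀ s t : ℕ, t ∈ Finset.range (Q ^ K.card + 1) → s < t → F s = F t →
      ∃ q : ℕ, 1 ≤ q ∧ q ≤ Q ^ K.card ∧
        ∃ p : ι → ℤ, ∀ i ∈ K, |(q : ℝ) * x i - p i| ≤ 1 / Q := by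
    intro s t ht hst h
    refine ⟨t - s, by omega, by have := Finset.mem_range.1 ht; omega,
      fun i => ⌊(t : ℝ) * x i⌋ - ⌊(s : ℝ) * x i⌋, fun i hi => ?_⟩
    have h1 : ⌊(Q : ℝ) * Int.fract ((s : ℝ) * x i)⌋₊ = ⌊(Q : ℝ) * Int.fract ((t : ℝ) * x i)⌋₊ :=
      congrFun h ⟨i, hi⟩
    have h2 : ((t - s : ℕ) : ℝ) * x i - ((⌊(t : ℝ) * x i⌋ - ⌊(s : ℝ) * x i⌋ : ℤ) : ℝ) =
        Int.fract ((t : ℝ) * x i) - Int.fract ((s : ℝ) * x i) := by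
      rw [Nat.cast_sub hst.le, Int.fract, Int.fract]; push_cast; ring
    rw [h2]
    have a1 := Nat.floor_le (mul_nonneg hQ'.le (Int.fract_nonneg ((s : ℝ) * x i)))
    have a2 := Nat.lt_floor_add_one ((Q : ℝ) * Int.fract ((s : ℝ) * x i))
    have b1 := Nat.floor_le (mul_nonneg hQ'.le (Int.fract_nonneg ((t : ℝ) * x i)))
    have b2 := Nat.lt_floor_add_one ((Q : ℝ) * Int.fract ((t : ℝ) * x i))
    rw [h1] at a1 a2
    rw [abs_le, ← neg_div, div_le_iff₀ hQ', le_div_iff₀ hQ']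
    constructor <;> nlinarith
  rcases lt_or_gt_of_ne hst with h | h
  · exact key s t ht h hFst
  · exact key t s hs h hFst.symm

/-- Nonnegative numbers, those outside `Z` being small, have a multiplicative gap below a
set of large ones inside `Z`. -/
theorem exists_gap {m : ℕ} (M : ℕ → ℝ) (hM : ∀ k, 1 ≤ M k) (lam : Fin m → ℝ)
    (Z : Finset (Fin m)) {i₀ i₁ : Fin m} (hi₀ : i₀ ∉ Z) (hi₁ : 0 < lam i₁)
    (hZ : ∀ i ∉ Z, lam i * ∏ k ∈ Finset.range (m - 1), M k < lam i₁) :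
    ∃ K ⊆ Z, ∃ κ, K.card = κ + 1 ∧
      (∀ i ∈ K, lam i₁ ≤ (∏ k ∈ Finset.range κ, M k) * lam i) ∧
      ∀ i ∉ K, ∀ j ∈ K, lam i * M κ < lam j := by
  classical
  have hmono : Monotone fun n => ∏ k ∈ Finset.range n, M k := monotone_nat_of_le_succ fun n => by
    rw [Finset.prod_range_succ]
    exact le_mul_of_one_le_right (Finset.prod_nonneg fun k _ => zero_le_one.trans (hM k)) (hM n)
  have hone : ∀ n, 1 ≤ ∏ k ∈ Finset.range n, M k := fun n => by simpa using hmono (Nat.zero_le n)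
  have hi₁Z : i₁ ∈ Z := by
    by_contra h
    have := hZ i₁ h
    nlinarith [hone (m - 1)]
  -- A largest such `K` has the gap: an outside index within factor `M κ` of a member could be added
  -- to `K`, at the cost of one more factor in the product.
  set T := Z.powerset.filter fun K => K.Nonempty ∧
    ∀ i ∈ K, lam i₁ ≤ (∏ k ∈ Finset.range (K.card - 1), M k) * lam i with hT
  have hTne : T.Nonempty := ⟨{i₁}, by simp [hT, hi₁Z]⟩
  obtain ⟨K, hKT, hKmax⟩ := T.exists_max_image Finset.card hTne
  obtain ⟨hKZ, hKne, hK⟩ := Finset.mem_filter.1 hKT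
  have hKZ := Finset.mem_powerset.1 hKZ
  obtain ⟨κ, hκ⟩ : ∃ κ, K.card = κ + 1 := ⟨K.card - 1, by have := hKne.card_pos; omega⟩
  rw [hκ, Nat.add_sub_cancel] at hK
  refine ⟨K, hKZ, κ, hκ, hK, fun i hi j hj => ?_⟩
  by_contra! hle
  -- `K` misses `i₀`, so the product never uses more than the `m - 1` factors available in `hZ`.
  -- Hence an index outside `Z` is too small to be the added one.
  have hcard : κ + 1 ≤ m - 1 := by
    have h1 : K ⊂ Finset.univ := Finset.ssubset_univ_iff.2 fun h => hi₀ (hKZ (h ▸ Finset.mem_univ _))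
    have := Finset.card_lt_card h1
    rw [Finset.card_univ, Fintype.card_fin] at this
    omega
  have hstep : lam i₁ ≤ (∏ k ∈ Finset.range (κ + 1), M k) * lam i := by
    rw [Finset.prod_range_succ, mul_assoc, mul_comm (M κ)]
    exact (hK j hj).trans (mul_le_mul_of_nonneg_left hle (zero_le_one.trans (hone κ)))
  have hipos : 0 < lam i := by
    by_contra! h
    have := mul_nonneg (zero_le_one.trans (hone (κ + 1))) (neg_nonneg.2 h)
    linarith
  have hiZ : i ∈ Z := by
    by_contra h
    have h1 := hZ i h
    have h2 : ∏ k ∈ Finset.range (κ + 1), M k ≤ ∏ k ∈ Finset.range (m - 1), M k := hmono hcard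
    nlinarith
  have hins : insert i K ∈ T := by
    refine Finset.mem_filter.2 ⟨Finset.mem_powerset.2 (Finset.insert_subset hiZ hKZ),
      Finset.insert_nonempty _ _, fun l hl => ?_⟩
    rw [Finset.card_insert_of_notMem hi, hκ, Nat.add_sub_cancel]
    rcases Finset.mem_insert.1 hl with rfl | hl
    · exact hstep
    · have hlpos : 0 < lam l := by
        by_contra! h
        have := mul_nonneg (zero_le_one.trans (hone κ)) (neg_nonneg.2 h)
        linarith [hK l hl]
      exact (hK l hl).trans (mul_le_mul_of_nonneg_right (hmono (Nat.le_succ κ)) hlpos.le)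
  have := hKmax _ hins
  rw [Finset.card_insert_of_notMem hi] at this
  omega

/-- Positive numbers `lam i ≥ lam i₁`, `i ∈ K`, are approximated by `ρ p i` with positive integers
`p i`, exactly at `i₁`. -/
theorem exists_integer_direction {ι : Type*} [DecidableEq ι] {K : Finset ι} {lam : ι → ℝ}
    {i₁ : ι} (hi₁ : i₁ ∈ K) (hpos : 0 < lam i₁) (hmin : ∀ i ∈ K, lam i₁ ≤ lam i) {κ : ℕ}
    (hκ : K.card = κ + 1) {Q : ℕ} (hQ : 2 ≤ Q) :
    ∃ (p : ι → ℤ) (ρ : ℝ), (∀ i ∉ K, p i = 0) ∧ (∀ i ∈ K, 1 ≤ p i) ∧ 0 < ρ ∧ ρ ≤ lam i₁ ∧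
      lam i₁ ≤ ρ * Q ^ κ ∧ (∀ i ∈ K, |lam i - ρ * p i| ≤ ρ / Q) ∧ lam i₁ = ρ * p i₁ := by
  have hQ' : (2 : ℝ) ≤ Q := by exact_mod_cast hQ
  -- Only the `κ` ratios to `lam i₁` need approximation, whence the exponent `κ`. The denominator
  -- `q` becomes `p i₁`, and `ρ = lam i₁ / q`.
  obtain ⟨q, hq1, hqQ, p, hp⟩ := exists_simultaneous_approx (K.erase i₁)
    (fun i => lam i / lam i₁) (Q := Q) (by omega)
  rw [Finset.card_erase_of_mem hi₁, hκ, Nat.add_sub_cancel] at hqQ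
  have hq1' : (1 : ℝ) ≤ q := by exact_mod_cast hq1
  have hq0 : (0 : ℝ) < q := by linarith
  have hρ : 0 < lam i₁ / q := by positivity
  refine ⟨fun i => if i = i₁ then q else if i ∈ K then p i else 0, lam i₁ / q, fun i hi => ?_,
    fun i hi => ?_, hρ, div_le_self hpos.le hq1', ?_, fun i hi => ?_, ?_⟩
  · have : i ≠ i₁ := fun h => hi (h ▸ hi₁)
    simp [this, hi]
  · by_cases h : i = i₁
    · simpa [h] using hq1
    · have h1 := hp i (Finset.mem_erase.2 ⟨h, hi⟩)
      have h2 : (1 : ℝ) ≤ lam i / lam i₁ := (one_le_div hpos).2 (hmin i hi)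
      have h3 : (1 : ℝ) / Q ≤ 1 / 2 := one_div_le_one_div_of_le two_pos hQ'
      have h4 : (0 : ℝ) < p i := by
        have := (abs_le.1 h1).2
        nlinarith
      simp only [h, hi, if_true, if_false]
      exact_mod_cast h4
  · rw [div_mul_eq_mul_div, le_div_iff₀ hq0]
    exact mul_le_mul_of_nonneg_left (by exact_mod_cast hqQ) hpos.le
  · by_cases h : i = i₁
    · subst h
      simp only [if_true, Int.cast_natCast]
      rw [div_mul_cancel₀ _ hq0.ne', sub_self, abs_zero]
      positivity
    · have h1 := hp i (Finset.mem_erase.2 ⟨h, hi⟩)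
      simp only [h, hi, if_true, if_false]
      have : lam i - lam i₁ / q * p i = lam i₁ / q * (q * (lam i / lam i₁) - p i) := by
        field_simp
      rw [this, abs_mul, abs_of_pos hρ, div_eq_mul_one_div (lam i₁ / (q : ℝ)) (Q : ℝ)]
      exact mul_le_mul_of_nonneg_left h1 hρ.le
  · simp [div_mul_cancel₀ _ hq0.ne']

/-- The main estimate: if `∑ p i w i ≥ 1` then `∑ (lam i - s p i) w i` is large. -/
theorem half_sub_le_sum {ι : Type*} [DecidableEq ι] {K : Finset ι} {lam : ι → ℝ} {p : ι → ℤ}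
    {w : ι → ℝ} {i₁ : ι} {κ m : ℕ} {B P Q s ρ : ℝ} (hi₁ : i₁ ∈ K) (hκ : K.card = κ + 1)
    (hκm : κ + 2 ≤ m) (hmin : ∀ i ∈ K, lam i₁ ≤ lam i) (hmax : ∀ i ∈ K, lam i ≤ P * lam i₁)
    (hB : 1 ≤ B) (hP : κ ≠ 0 → 2 * m * B ≤ P) (hP1 : 1 ≤ P) (hQ : Q = 2 * m * B * P) (hs : 0 ≤ s)
    (hsρ : 4 * s ≤ ρ) (hρ : 0 < ρ) (hρL : ρ ≤ lam i₁)
    (happ : ∀ i ∈ K, |lam i - ρ * p i| ≤ ρ / Q) (happ₁ : lam i₁ = ρ * p i₁)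
    (hw : ∀ i ∈ K, -B ≤ w i) (hpw : 1 ≤ ∑ i ∈ K, p i * w i) :
    ρ / 2 - s ≤ ∑ i ∈ K, (lam i - s * p i) * w i := by
  have hm : (κ : ℝ) + 2 ≤ m := by exact_mod_cast hκm
  have hκ0 : (0 : ℝ) ≤ κ := Nat.cast_nonneg κ
  have hmB : (m : ℝ) ≤ m * B := le_mul_of_one_le_right (by linarith) hB
  have hQ1 : 1 ≤ Q := by rw [hQ]; nlinarith
  have hQ0 : 0 < Q := by linarith
  set T := ∑ i ∈ K.erase i₁, |w i| with hT
  -- For small `T`, replacing `lam` by `ρ p` costs at most `ρ / 2`, and `∑ p w ≥ 1` finishes. For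
  -- large `T`, some `w i` must be large and positive because all are at least `-B`, and these
  -- outweigh the negative terms.
  rcases le_or_gt T (Q / 2) with hTQ | hTQ
  · have h1 : ∑ i ∈ K, (lam i - s * p i) * w i =
        (ρ - s) * ∑ i ∈ K, p i * w i + ∑ i ∈ K, (lam i - ρ * p i) * w i := by
      rw [Finset.mul_sum, ← Finset.sum_add_distrib]
      exact Finset.sum_congr rfl fun i _ => by ring
    have h2 : -(ρ / Q * T) ≤ ∑ i ∈ K, (lam i - ρ * p i) * w i := by
      rw [← Finset.add_sum_erase K _ hi₁, ← happ₁, sub_self, zero_mul, zero_add, hT,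
        Finset.mul_sum, ← Finset.sum_neg_distrib]
      refine Finset.sum_le_sum fun i hi => ?_
      have h3 : |(lam i - ρ * p i) * w i| ≤ ρ / Q * |w i| := by
        rw [abs_mul]
        exact mul_le_mul_of_nonneg_right (happ i (Finset.mem_of_mem_erase hi)) (abs_nonneg _)
      exact (abs_le.1 h3).1
    have h4 : ρ / Q * T ≤ ρ / 2 := by
      calc ρ / Q * T ≤ ρ / Q * (Q / 2) := mul_le_mul_of_nonneg_left hTQ (by positivity)
        _ = ρ / 2 := by field_simp
    have h5 : (ρ - s) * 1 ≤ (ρ - s) * ∑ i ∈ K, p i * w i :=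
      mul_le_mul_of_nonneg_left hpw (by linarith)
    linarith
  · have hκne : κ ≠ 0 := by
      rintro rfl
      have h1 : K.erase i₁ = ∅ := Finset.card_eq_zero.1 (by rw [Finset.card_erase_of_mem hi₁, hκ])
      rw [hT, h1, Finset.sum_empty] at hTQ
      linarith
    have hP' : (κ : ℝ) + 2 ≤ P := by
      have := hP hκne
      nlinarith
    set L := lam i₁ with hL
    have hL0 : 0 < L := by linarith
    -- With `s = θ ρ`, the coefficient `lam i - s p i` equals `(1 - θ) lam i` up to an error `η`, so
    -- it stays positive and within a factor of about `P` of `(1 - θ) L`.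
    set θ := s / ρ with hθ
    have hθ0 : 0 ≤ θ := div_nonneg hs hρ.le
    have hθ4 : θ ≤ 1 / 4 := by rw [hθ, div_le_iff₀ hρ]; linarith
    have hsθ : s = θ * ρ := by rw [hθ, div_mul_cancel₀ _ hρ.ne']
    set η := θ * (ρ / Q) with hη
    have hη0 : 0 ≤ η := by positivity
    have hηQ : η * (Q / 2) = θ * ρ / 2 := by rw [hη]; field_simp
    have hθρ : θ * ρ ≤ 1 / 4 * L := mul_le_mul hθ4 hρL hρ.le (by norm_num)
    have hηL : η ≤ 1 / 4 * L := by
      rw [hη]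
      exact mul_le_mul hθ4 ((div_le_self hρ.le hQ1).trans hρL) (by positivity) (by norm_num)
    have hθL : 3 / 4 * L ≤ (1 - θ) * L := mul_le_mul_of_nonneg_right (by linarith) hL0.le
    have hd : ∀ i ∈ K, (1 - θ) * L - η ≤ lam i - s * p i ∧
        lam i - s * p i ≤ (1 - θ) * (P * L) + η := by
      intro i hi
      have h1 : lam i - s * p i = (1 - θ) * lam i + θ * (lam i - ρ * p i) := by rw [hsθ]; ring
      have h2 := abs_le.1 (happ i hi)
      have h3 := mul_le_mul_of_nonneg_left h2.1 hθ0
      have h4 := mul_le_mul_of_nonneg_left h2.2 hθ0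
      have h5 : (1 - θ) * L ≤ (1 - θ) * lam i :=
        mul_le_mul_of_nonneg_left (hmin i hi) (by linarith)
      have h6 : (1 - θ) * lam i ≤ (1 - θ) * (P * L) :=
        mul_le_mul_of_nonneg_left (hmax i hi) (by linarith)
      rw [h1]
      constructor <;> linarith
    have hterm : ∀ i ∈ K.erase i₁, ((1 - θ) * L - η) * |w i| - (1 - θ) * (P + 1) * L * B ≤
        (lam i - s * p i) * w i := by
      intro i hi
      have hiK := Finset.mem_of_mem_erase hi
      obtain ⟨h1, h2⟩ := hd i hiK
      have h3 := hw i hiK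
      have h4 : 0 ≤ (1 - θ) * (P + 1) * L :=
        mul_nonneg (mul_nonneg (by linarith) (by linarith)) hL0.le
      rcases le_total 0 (w i) with hwi | hwi
      · rw [abs_of_nonneg hwi]
        have := mul_le_mul_of_nonneg_right h1 hwi
        have := mul_nonneg h4 (zero_le_one.trans hB)
        linarith
      · rw [abs_of_nonpos hwi]
        have h5 := mul_le_mul_of_nonpos_right h2 hwi
        have h6 := mul_le_mul_of_nonneg_left h3 h4
        nlinarith
    have hsum := Finset.sum_le_sum hterm
    rw [Finset.sum_sub_distrib, ← Finset.mul_sum, ← hT, Finset.sum_const,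
      Finset.card_erase_of_mem hi₁, hκ, Nat.add_sub_cancel, nsmul_eq_mul] at hsum
    rw [← Finset.add_sum_erase K _ hi₁]
    have hfirst : -((1 - θ) * L * B) ≤ (L - s * p i₁) * w i₁ := by
      have h1 : L - s * p i₁ = (1 - θ) * L := by rw [hsθ, mul_assoc, ← happ₁]; ring
      rw [h1]
      have h2 := mul_le_mul_of_nonneg_left (hw i₁ hi₁) (by linarith : 0 ≤ (1 - θ) * L)
      linarith
    have hlT : ((1 - θ) * L - η) * (Q / 2) ≤ ((1 - θ) * L - η) * T :=
      mul_le_mul_of_nonneg_left hTQ.le (by linarith)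
    have hlQ : ((1 - θ) * L - η) * (Q / 2) = (1 - θ) * L * (m * B * P) - θ * ρ / 2 := by
      rw [sub_mul, hηQ, hQ]; ring
    -- The gain from `T > m B P` exceeds the possible loss of the `κ + 1` terms; `κ + 2 ≤ m` and `κ
    -- + 2 ≤ P` are what this takes.
    have hbr : 2 ≤ B * (m * P - κ * (P + 1) - 1) := by
      have h1 : (κ + 2) * P ≤ m * P := mul_le_mul_of_nonneg_right hm (by linarith)
      have h2 : 2 ≤ m * P - κ * (P + 1) - 1 := by linarith
      calc (2 : ℝ) ≤ m * P - κ * (P + 1) - 1 := h2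
        _ ≤ _ := le_mul_of_one_le_left (by linarith) hB
    have hfin : (1 - θ) * L * 2 ≤ (1 - θ) * L * (B * (m * P - κ * (P + 1) - 1)) :=
      mul_le_mul_of_nonneg_left hbr (by linarith)
    have : (1 - θ) * L * (B * (m * P - κ * (P + 1) - 1)) = (1 - θ) * L * (m * B * P) -
        κ * ((1 - θ) * (P + 1) * L * B) - (1 - θ) * L * B := by ring
    linarith

/-! ### The constants. -/

/-- With `P` the product and `Q = 2 m B P`, the constant is `Q ^ κ M₁`: the Dirichlet bound for `κ`
ratios times the room `M₁` needed for the remaining rows. -/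
theorem constMi_eq (m : ℕ) (B D : ℤ) (κ : ℕ) : constMi m B D κ =
    (2 * m * B * ∏ j ∈ Finset.range κ, constMi m B D j) ^ κ * (2 * (m * B + 2 * D)) := by
  rw [constMi, Fin.prod_univ_eq_prod_range (fun j => constMi m B D j)]

theorem one_le_constMi {m : ℕ} {B D : ℤ} (hm : 1 ≤ m) (hB : 1 ≤ B) (hD : 0 ≤ D) (κ : ℕ) :
    1 ≤ constMi m B D κ := by
  induction κ using Nat.strong_induction_on with
  | _ κ ih =>
    rw [constMi_eq]
    have h1 : 0 < ∏ j ∈ Finset.range κ, constMi m B D j := Finset.prod_pos fun j hj =>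
      ih j (Finset.mem_range.1 hj)
    have : 0 < (m : ℤ) := by exact_mod_cast hm
    have : 0 < B := hB
    refine Order.one_le_iff_pos.2 ?_
    positivity

theorem one_le_prod_constMi {m : ℕ} {B D : ℤ} (hm : 1 ≤ m) (hB : 1 ≤ B) (hD : 0 ≤ D) (κ : ℕ) :
    1 ≤ ∏ j ∈ Finset.range κ, constMi m B D j :=
  Int.add_one_le_of_lt (Finset.prod_pos fun j _ => one_le_constMi hm hB hD j)

theorem le_prod_constMi {m : ℕ} {B D : ℤ} (hm : 1 ≤ m) (hB : 1 ≤ B) (hD : 0 ≤ D) {κ : ℕ}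
    (hκ : κ ≠ 0) : 2 * m * B ≤ ∏ j ∈ Finset.range κ, constMi m B D j := by
  obtain ⟨κ, rfl⟩ := Nat.exists_eq_succ_of_ne_zero hκ
  rw [Finset.prod_range_succ']
  have h0 : constMi m B D 0 = 2 * (m * B + 2 * D) := by rw [constMi_eq]; simp
  have h1 : 1 ≤ ∏ j ∈ Finset.range κ, constMi m B D (j + 1) :=
    Int.add_one_le_of_lt (Finset.prod_pos fun j _ => one_le_constMi hm hB hD _)
  have h2 : 0 ≤ (m : ℤ) * B := by positivity
  rw [h0]
  nlinarith

theorem le_constB {m : ℕ} (b : Fin m → ℤ) (i : Fin m) : b i ≤ constB b :=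
  le_ciSup (Set.finite_range b).bddAbove i

theorem sum_dotProduct_le_constD {m n₁ n₂ h : ℕ} {r : Fin h → Fin (n₁ + n₂) → ℤ}
    {A : Matrix (Fin m) (Fin (n₁ + n₂)) ℤ} (hAe : ∀ i k, 0 ≤ A i ⬝ᵥ unitVec n₁ n₂ k)
    (hAr : ∀ i j, 0 ≤ A i ⬝ᵥ r j) (j : Fin h) : ∑ i, A i ⬝ᵥ r j ≤ constD r A := by
  refine Finset.sum_le_sum fun i _ => ?_
  rw [dotProduct_add, dotProduct_sum, dotProduct_sum]
  have h1 : 0 ≤ ∑ k, A i ⬝ᵥ unitVec n₁ n₂ k := Finset.sum_nonneg fun k _ => hAe i k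
  have h2 : A i ⬝ᵥ r j ≤ ∑ j, A i ⬝ᵥ r j :=
    Finset.single_le_sum (f := fun j => A i ⬝ᵥ r j) (fun k _ => hAr i k) (Finset.mem_univ j)
  linarith

/-! ### Duality and the domination of cuts with large intercepts. -/

section Duality

variable {m n : ℕ} {A : Matrix (Fin m) (Fin n) ℤ} {b : Fin m → ℤ} {lam : Fin m → ℝ}

/-- Complementary slackness. -/
theorem exists_tight_of_isLeast (hlam : ∀ i, 0 ≤ lam i) {α : Fin n → ℤ}
    (hα : toReal α = ∑ i, lam i • toReal (A i))
    (hmin : IsLeast ((fun x => toReal α ⬝ᵥ x) '' upPoly A b) (∑ i, lam i * (b i : ℝ))) :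
    ∃ x ∈ upPoly A b, ∀ i, lam i ≠ 0 → toReal (A i) ⬝ᵥ x = b i := by
  obtain ⟨⟨x, hx, hxβ⟩, -⟩ := hmin
  refine ⟨x, hx, fun i hi => ?_⟩
  simp only [hα, sum_dotProduct, smul_dotProduct, smul_eq_mul] at hxβ
  have h1 : ∀ i ∈ Finset.univ, 0 ≤ lam i * (toReal (A i) ⬝ᵥ x - b i) := fun i _ =>
    mul_nonneg (hlam i) (sub_nonneg.2 (hx i))
  have h2 : ∑ i, lam i * (toReal (A i) ⬝ᵥ x - b i) = 0 := by
    simp only [mul_sub, Finset.sum_sub_distrib, hxβ, sub_self]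
  have h3 := (Finset.sum_eq_zero_iff_of_nonneg h1).1 h2 i (Finset.mem_univ i)
  linarith [(mul_eq_zero.1 h3).resolve_left hi]

/-- By weak duality one tight point certifies optimality. Only the support of `lam` matters, so
multipliers may be decreased without leaving `Π_{P↑}` as long as `α` stays integral. -/
theorem mem_upPi_of_tight (hlam : ∀ i, 0 ≤ lam i) {α : Fin n → ℤ}
    (hα : toReal α = ∑ i, lam i • toReal (A i)) {x : Fin n → ℝ} (hx : x ∈ upPoly A b)
    (htight : ∀ i, lam i ≠ 0 → toReal (A i) ⬝ᵥ x = b i) :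
    (α, ∑ i, lam i * (b i : ℝ)) ∈ upPi A b := by
  refine ⟨lam, hlam, hα, rfl, ⟨x, hx, ?_⟩, ?_⟩
  · simp only [hα, sum_dotProduct, smul_dotProduct, smul_eq_mul]
    refine Finset.sum_congr rfl fun i _ => ?_
    by_cases hi : lam i = 0
    · simp [hi]
    · rw [htight i hi]
  · rintro _ ⟨y, hy, rfl⟩
    simp only [hα, sum_dotProduct, smul_dotProduct, smul_eq_mul]
    exact Finset.sum_le_sum fun i _ => mul_le_mul_of_nonneg_left (hy i) (hlam i)

end Duality

/-- Walking from `z` along the ray raises `α` in steps of `α ⬝ᵥ ray`, so the first value reaching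
`β` overshoots by less than one step. -/
theorem IsSCeil.le_add {n : ℕ} {S : Set (Fin n → ℤ)} {α ray z : Fin n → ℤ} {β c : ℝ}
    (hc : IsSCeil S α β c) (hz : ∀ k : ℕ, z + (k : ℤ) • ray ∈ S)
    (hzβ : toReal α ⬝ᵥ toReal z ≤ β) (hs : 0 < α ⬝ᵥ ray) : c ≤ β + ((α ⬝ᵥ ray : ℤ) : ℝ) := by
  set s := α ⬝ᵥ ray with hs_def
  have hs' : (0 : ℝ) < s := by exact_mod_cast hs
  set k := ⌈(β - toReal α ⬝ᵥ toReal z) / s⌉₊ with hk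
  have h1 : (β - toReal α ⬝ᵥ toReal z) / s ≤ k := Nat.le_ceil _
  have h2 : (k : ℝ) < (β - toReal α ⬝ᵥ toReal z) / s + 1 :=
    Nat.ceil_lt_add_one (div_nonneg (by linarith) hs'.le)
  have h3 : toReal α ⬝ᵥ toReal (z + (k : ℤ) • ray) = toReal α ⬝ᵥ toReal z + k * s := by
    rw [toReal_add, toReal_smul, dotProduct_add, dotProduct_smul, toReal_dotProduct α ray,
      smul_eq_mul, Int.cast_natCast]
  rw [div_le_iff₀ hs'] at h1
  have h4 : (k : ℝ) * s < β - toReal α ⬝ᵥ toReal z + s := by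
    have := mul_lt_mul_of_pos_right h2 hs'
    rwa [add_mul, div_mul_cancel₀ _ hs'.ne', one_mul] at this
  have := hc.2 ⟨by linarith, _, hz k, h3.symm⟩
  linarith

/-- A cut with a large intercept is implied by one with smaller multipliers. -/
theorem exists_dominating_cut {m n : ℕ} {S : Set (Fin n → ℤ)} {A : Matrix (Fin m) (Fin n) ℤ}
    {b : Fin m → ℤ} {ray : Fin n → ℤ} {D : ℤ} (hb : ∀ i, 0 ≤ b i) (hAr : ∀ i, 0 ≤ A i ⬝ᵥ ray)
    (hD : ∑ i, A i ⬝ᵥ ray ≤ D) (hray : ∀ z ∈ S, ∀ k : ℕ, z + (k : ℤ) • ray ∈ S)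
    (hSA : ∀ z ∈ S, ∀ i, 0 ≤ A i ⬝ᵥ z)
    {lam : Fin m → ℝ} (hlam : ∀ i, 0 ≤ lam i) {α : Fin n → ℤ}
    (hα : toReal α = ∑ i, lam i • toReal (A i))
    {z₀ : Fin n → ℤ} (hz₀ : z₀ ∈ S) (hz₀β : toReal α ⬝ᵥ toReal z₀ ≤ ∑ i, lam i * (b i : ℝ))
    (hs : 0 < α ⬝ᵥ ray)
    (hbig : ((m * constB b * constM m (constB b) D : ℤ) : ℝ) <
      (∑ i, lam i * (b i : ℝ)) / ((α ⬝ᵥ ray : ℤ) : ℝ)) :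
    ∃ μ : Fin m → ℤ, (∀ i, 0 ≤ μ i) ∧ (∃ i, 1 ≤ μ i) ∧ (∀ i, (μ i : ℝ) ≤ lam i) ∧
      ∀ c c' : ℝ, IsSCeil S α (∑ i, lam i * (b i : ℝ)) c →
        IsSCeil S (α - ∑ i, μ i • A i) (∑ i, (lam i - μ i) * (b i : ℝ)) c' →
          c ≤ c' + ∑ i, (μ i : ℝ) * b i := by
  classical
  set s := α ⬝ᵥ ray with hs_def
  have hs1 : (1 : ℝ) ≤ s := by exact_mod_cast hs
  have hs0 : (0 : ℝ) < s := by linarith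
  have hs_sum : (s : ℝ) = ∑ i, lam i * ((A i ⬝ᵥ ray : ℤ) : ℝ) := by
    rw [hs_def, ← toReal_dotProduct, hα, sum_dotProduct]
    simp only [smul_dotProduct, toReal_dotProduct, smul_eq_mul]
  have hArR : ∀ i, (0 : ℝ) ≤ ((A i ⬝ᵥ ray : ℤ) : ℝ) := fun i => by exact_mod_cast hAr i
  have hterm : ∀ i ∈ Finset.univ, 0 ≤ lam i * ((A i ⬝ᵥ ray : ℤ) : ℝ) := fun i _ =>
    mul_nonneg (hlam i) (hArR i)
  obtain ⟨i₀, hi₀⟩ : ∃ i, 0 < lam i * ((A i ⬝ᵥ ray : ℤ) : ℝ) := by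
    by_contra! h
    have := Finset.sum_nonpos fun i (_ : i ∈ Finset.univ) => h i
    linarith
  have hi₀lam : 0 < lam i₀ := (hlam i₀).lt_of_ne fun h => by rw [← h, zero_mul] at hi₀; simp at hi₀
  have hi₀A : A i₀ ⬝ᵥ ray ≠ 0 := fun h => by rw [h] at hi₀; simp at hi₀
  have hm : 1 ≤ m := Nat.one_le_iff_ne_zero.2 fun h => (h ▸ i₀).elim0
  set B := constB b with hBdef
  have hbB : ∀ i, b i ≤ B := le_constB b
  rw [lt_div_iff₀ hs0] at hbig
  obtain ⟨i₁, -, hi₁⟩ := Finset.exists_max_image Finset.univ lam ⟨i₀, Finset.mem_univ _⟩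
  have hi₁pos : 0 < lam i₁ := hi₀lam.trans_le (hi₁ i₀ (Finset.mem_univ _))
  have hβle : ∑ i, lam i * (b i : ℝ) ≤ m * B * lam i₁ := by
    calc ∑ i, lam i * (b i : ℝ) ≤ ∑ _i : Fin m, lam i₁ * (B : ℝ) :=
          Finset.sum_le_sum fun i hi => mul_le_mul (hi₁ i hi) (by exact_mod_cast hbB i)
            (by exact_mod_cast hb i) hi₁pos.le
      _ = m * B * lam i₁ := by
          rw [Finset.sum_const, Finset.card_univ, Fintype.card_fin, nsmul_eq_mul]; ring
  have hB0 : 0 ≤ B := (hb i₀).trans (hbB i₀)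
  have hB : 1 ≤ B := by
    by_contra! h
    have hB0 : B = 0 := by omega
    rw [hB0] at hβle hbig
    simp at hβle hbig
    linarith
  have hBR : (1 : ℝ) ≤ B := by exact_mod_cast hB
  have hmR : (1 : ℝ) ≤ m := by exact_mod_cast hm
  have hmB : (0 : ℝ) < m * B := by positivity
  have hD0 : 0 ≤ D := (Finset.sum_nonneg fun i _ => hAr i).trans hD
  have hD0R : (0 : ℝ) ≤ D := by exact_mod_cast hD0
  -- This is where `M* = m B M` enters: `s m B M < β ≤ m B lam i₁`.
  have hlarge : s * ∏ k ∈ Finset.range (m - 1), (constMi m B D k : ℝ) < lam i₁ := by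
    have h1 := hbig.trans_le hβle
    rw [constM] at h1
    push_cast at h1
    refine lt_of_mul_lt_mul_left ?_ hmB.le
    linarith
  set Z := Finset.univ.filter fun i => A i ⬝ᵥ ray = 0 with hZ
  have hone : ∀ k, (1 : ℝ) ≤ constMi m B D k := fun k => by
    exact_mod_cast one_le_constMi hm hB hD0 k
  obtain ⟨K, hKZ, κ, hκ, hKP, hKgap⟩ := exists_gap (fun k => (constMi m B D k : ℝ)) hone lam Z
    (i₀ := i₀) (by simp [hZ, hi₀A]) hi₁pos (fun i hi => by
      have h1 : A i ⬝ᵥ ray ≠ 0 := by simpa [hZ] using hi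
      have h2 : (1 : ℝ) ≤ ((A i ⬝ᵥ ray : ℤ) : ℝ) := by
        have := hAr i
        exact_mod_cast (by omega : 1 ≤ A i ⬝ᵥ ray)
      have h3 : lam i * ((A i ⬝ᵥ ray : ℤ) : ℝ) ≤ s := by
        rw [hs_sum]; exact Finset.single_le_sum hterm (Finset.mem_univ i)
      have h4 : lam i ≤ s := (le_mul_of_one_le_right (hlam i) h2).trans h3
      exact (mul_le_mul_of_nonneg_right h4
        (Finset.prod_nonneg fun k _ => zero_le_one.trans (hone k))).trans_lt hlarge)
  have hKray : ∀ i ∈ K, A i ⬝ᵥ ray = 0 := fun i hi => (Finset.mem_filter.1 (hKZ hi)).2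
  have hκm : κ + 2 ≤ m := by
    have h1 : K ⊂ Finset.univ := Finset.ssubset_univ_iff.2 fun h =>
      hi₀A (hKray i₀ (h ▸ Finset.mem_univ _))
    have := Finset.card_lt_card h1
    rw [Finset.card_univ, Fintype.card_fin] at this
    omega
  set P := ∏ k ∈ Finset.range κ, constMi m B D k with hPdef
  have hP1 : 1 ≤ P := one_le_prod_constMi hm hB hD0 κ
  have hP1R : (1 : ℝ) ≤ P := by exact_mod_cast hP1
  have hPcast : ∏ k ∈ Finset.range κ, (constMi m B D k : ℝ) = P := by rw [hPdef]; push_cast; rfl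
  rw [hPcast] at hKP
  obtain ⟨i₂, hi₂K, hi₂⟩ := Finset.exists_min_image K lam (Finset.card_pos.1 (by omega))
  have hi₂pos : 0 < lam i₂ := by
    have h1 := hKP i₂ hi₂K
    by_contra! h
    nlinarith
  obtain ⟨Q, hQ⟩ : ∃ Q : ℕ, (Q : ℤ) = 2 * m * B * P :=
    ⟨(2 * m * B * P).toNat, Int.toNat_of_nonneg (by positivity)⟩
  have hQR : (Q : ℝ) = 2 * m * B * P := by exact_mod_cast hQ
  have hmBR : (1 : ℝ) ≤ m * B := one_le_mul_of_one_le_of_one_le hmR hBR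
  have hmBP : (1 : ℝ) ≤ m * B * P := one_le_mul_of_one_le_of_one_le hmBR hP1R
  have hQ2R : (2 : ℝ) ≤ Q := by rw [hQR]; linarith
  obtain ⟨p, ρ, hp0, hp1, hρ, hρL, hρQ, happ, happ₂⟩ :=
    exists_integer_direction hi₂K hi₂pos hi₂ hκ (Q := Q) (by exact_mod_cast hQ2R)
  set M₁ : ℝ := 2 * (m * B + 2 * D) with hM₁
  have hM₁pos : 0 < M₁ := by positivity
  -- The gap factor is `Q ^ κ M₁` and `lam i₂ ≤ ρ Q ^ κ`, so `Q ^ κ` cancels.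
  have hrest : ∀ i ∉ K, lam i * M₁ ≤ ρ := fun i hi => by
    have h1 := (hKgap i hi i₂ hi₂K).trans_le hρQ
    have h2 : (constMi m B D κ : ℝ) = (Q : ℝ) ^ κ * M₁ := by
      rw [constMi_eq, ← hPdef, ← hQ]; push_cast; rfl
    rw [h2] at h1
    have h3 : (0 : ℝ) < (Q : ℝ) ^ κ := by positivity
    refine le_of_mul_le_mul_right ?_ h3
    linarith
  have hsM : s * M₁ ≤ ρ * D := by
    have h1 : (s : ℝ) * M₁ ≤ ∑ i, ρ * ((A i ⬝ᵥ ray : ℤ) : ℝ) := by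
      rw [hs_sum, Finset.sum_mul]
      refine Finset.sum_le_sum fun i _ => ?_
      by_cases hi : i ∈ K
      · simp [hKray i hi]
      · have := mul_le_mul_of_nonneg_right (hrest i hi) (hArR i)
        linarith
    rw [← Finset.mul_sum] at h1
    exact h1.trans (mul_le_mul_of_nonneg_left (by exact_mod_cast hD) hρ.le)
  have hsρ : 4 * s ≤ ρ := by
    refine le_of_mul_le_mul_right ?_ hM₁pos
    have : 0 ≤ ρ * (m * B) := by positivity
    rw [hM₁] at hsM ⊢
    linarith
  set R : ℝ := ∑ i ∈ Kᶜ, lam i * (b i : ℝ) with hR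
  have hRM : R * M₁ ≤ ρ * (m * B) := by
    have h1 : R * M₁ ≤ ∑ _i ∈ Kᶜ, ρ * (B : ℝ) := by
      rw [hR, Finset.sum_mul]
      refine Finset.sum_le_sum fun i hi => ?_
      have h2 : (b i : ℝ) ≤ B := by exact_mod_cast hbB i
      have h3 : (0 : ℝ) ≤ b i := by exact_mod_cast hb i
      calc lam i * (b i : ℝ) * M₁ = lam i * M₁ * b i := by ring
        _ ≤ ρ * B := mul_le_mul (hrest i (Finset.mem_compl.1 hi)) h2 h3 hρ.le
    rw [Finset.sum_const, nsmul_eq_mul] at h1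
    have h2 : ((Kᶜ.card : ℕ) : ℝ) ≤ m := by
      exact_mod_cast (Finset.card_le_univ _).trans_eq (Fintype.card_fin m)
    have h3 : (Kᶜ.card : ℝ) * (ρ * B) ≤ m * (ρ * B) :=
      mul_le_mul_of_nonneg_right h2 (by positivity)
    linarith
  -- `M₁ = 2 (m B + 2 D)` is chosen for this inequality: `m B` pays for `R` and `2 D` for `2 s`.
  have hsR : 2 * s + R ≤ ρ / 2 := by
    refine le_of_mul_le_mul_right ?_ hM₁pos
    have : ρ / 2 * M₁ = ρ * (m * B) + 2 * (ρ * D) := by rw [hM₁]; ring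
    linarith
  refine ⟨fun i => s * p i, fun i => ?_, ⟨i₂, ?_⟩, fun i => ?_, fun c c' hc hc' => ?_⟩
  · by_cases hi : i ∈ K
    · exact mul_nonneg hs.le (by linarith [hp1 i hi])
    · simp [hp0 i hi]
  · exact one_le_mul_of_one_le_of_one_le hs (hp1 i₂ hi₂K)
  · by_cases hi : i ∈ K
    · have h1 := (abs_le.1 (happ i hi)).1
      have h2 : ρ / Q ≤ ρ / 2 := div_le_div_of_nonneg_left hρ.le two_pos hQ2R
      have h3 : (1 : ℝ) ≤ p i := by exact_mod_cast hp1 i hi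
      push_cast
      nlinarith
    · simp [hp0 i hi, hlam i]
  · obtain ⟨hβc', z, hz, hzc'⟩ := hc'.1
    set y : Fin m → ℤ := fun i => A i ⬝ᵥ z with hy
    have hαz : toReal α ⬝ᵥ toReal z = c' + s * ∑ i, (p i : ℝ) * y i := by
      rw [hzc', toReal_sub, toReal_sum, sub_dotProduct, sum_dotProduct, Finset.mul_sum]
      simp only [toReal_smul, smul_dotProduct, toReal_dotProduct, smul_eq_mul, Int.cast_mul,
        hy, mul_assoc]
      ring
    have hμb : ∑ i, ((s * p i : ℤ) : ℝ) * (b i : ℝ) = s * ∑ i, (p i : ℝ) * b i := by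
      rw [Finset.mul_sum]
      exact Finset.sum_congr rfl fun i _ => by push_cast; ring
    have hβ' : ∑ i, (lam i - ((s * p i : ℤ) : ℝ)) * (b i : ℝ) =
        ∑ i, lam i * (b i : ℝ) - s * ∑ i, (p i : ℝ) * b i := by
      rw [← hμb, ← Finset.sum_sub_distrib]
      exact Finset.sum_congr rfl fun i _ => by ring
    rw [hμb]
    rw [hβ'] at hβc'
    set t : ℤ := ∑ i, p i * (y i - b i) with ht
    have htR : (t : ℝ) = ∑ i, (p i : ℝ) * y i - ∑ i, (p i : ℝ) * b i := by
      rw [ht, ← Finset.sum_sub_distrib]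
      push_cast
      exact Finset.sum_congr rfl fun i _ => by ring
    -- Since `μ = s p`, moving `z` by `-t` steps along the ray changes `α z` by exactly `-s t`,
    -- which gives the value `c' + μ b`. This needs `t ≤ 0`.
    rcases le_or_gt t 0 with ht0 | ht0
    · have h1 : toReal α ⬝ᵥ toReal (z + ((-t).toNat : ℤ) • ray) =
          c' + s * ∑ i, (p i : ℝ) * b i := by
        rw [Int.toNat_of_nonneg (by omega), toReal_add, toReal_smul, dotProduct_add,
          dotProduct_smul, toReal_dotProduct α ray, ← hs_def, hαz, smul_eq_mul]
        push_cast
        rw [htR]; ring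
      exact hc.2 ⟨by linarith, _, hray z hz _, h1.symm⟩
    -- Here `t ≥ 1`. The reduced cut exceeds its right-hand side by at least `ρ / 2 - s - R ≥ s`,
    -- which covers the rounding `c ≤ β + s`.
    · have hcs := hc.le_add (hray z₀ hz₀) hz₀β hs
      have hsumK : ∀ f : Fin m → ℝ, ∑ i, f i = ∑ i ∈ K, f i + ∑ i ∈ Kᶜ, f i := fun f =>
        (Finset.sum_add_sum_compl K f).symm
      have hpw : 1 ≤ ∑ i ∈ K, (p i : ℝ) * ((y i : ℝ) - b i) := by
        have h1 : ((t : ℤ) : ℝ) = ∑ i, (p i : ℝ) * ((y i : ℝ) - b i) := by rw [ht]; push_cast; rfl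
        rw [hsumK, Finset.sum_eq_zero (s := Kᶜ) (fun i hi => by
          rw [hp0 i (Finset.mem_compl.1 hi)]; simp), add_zero] at h1
        rw [← h1]
        exact_mod_cast ht0
      have hest := half_sub_le_sum (m := m) (B := B) (P := P) (Q := Q) (s := s) (ρ := ρ)
        hi₂K hκ hκm hi₂ (fun i hi => (hi₁ i (Finset.mem_univ i)).trans (hKP i₂ hi₂K)) hBR
        (fun h => by exact_mod_cast le_prod_constMi hm hB hD0 h) hP1R hQR hs0.le hsρ hρ hρL happ
        happ₂ (w := fun i => (y i : ℝ) - b i) (fun i _ => by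
          have h1 : (0 : ℝ) ≤ y i := by exact_mod_cast hSA z hz i
          have h2 : (b i : ℝ) ≤ B := by exact_mod_cast hbB i
          linarith) hpw
      have hc'sum : c' - (∑ i, lam i * (b i : ℝ) - s * ∑ i, (p i : ℝ) * b i) =
          ∑ i, (lam i - s * p i) * ((y i : ℝ) - b i) := by
        have h1 : c' = ∑ i, lam i * (y i : ℝ) - s * ∑ i, (p i : ℝ) * y i := by
          have : toReal α ⬝ᵥ toReal z = ∑ i, lam i * (y i : ℝ) := by
            rw [hα, sum_dotProduct]
            simp only [smul_dotProduct, toReal_dotProduct, smul_eq_mul, hy]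
          linarith
        rw [h1, Finset.mul_sum, Finset.mul_sum, ← Finset.sum_sub_distrib,
          ← Finset.sum_sub_distrib, ← Finset.sum_sub_distrib]
        exact Finset.sum_congr rfl fun i _ => by ring
      have hcompl : -R ≤ ∑ i ∈ Kᶜ, (lam i - s * p i) * ((y i : ℝ) - b i) := by
        rw [hR, ← Finset.sum_neg_distrib]
        refine Finset.sum_le_sum fun i hi => ?_
        rw [hp0 i (Finset.mem_compl.1 hi)]
        have h1 : (0 : ℝ) ≤ y i := by exact_mod_cast hSA z hz i
        have := mul_nonneg (hlam i) h1
        push_cast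
        linarith
      rw [hsumK fun i => (lam i - s * p i) * ((y i : ℝ) - b i)] at hc'sum
      rw [← hs_def] at hcs
      linarith

/-! ### Reduction to bounded intercepts. -/

section BoundedIntercepts

variable {m n h : ℕ} {S : Set (Fin n → ℤ)} {A : Matrix (Fin m) (Fin n) ℤ} {b : Fin m → ℤ}
  {r : Fin h → Fin n → ℤ} {D : ℤ}

/-- A row tight somewhere on `P↑` is itself a pair in `Π_{P↑}`. Its intercepts are `b i` divided by
positive integers, hence at most `M*`. This allows the rows removed by `μ` to be added back. -/
theorem row_le_of_mem_closureOver (hb : ∀ i, 0 ≤ b i) (hD : 0 ≤ D) {x y : Fin n → ℝ}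
    (hx : x ∈ closureOver S (upPiBounded r A b ((m * constB b * constM m (constB b) D : ℤ) : ℝ)))
    (hy : y ∈ upPoly A b) {i : Fin m} (hi : toReal (A i) ⬝ᵥ y = b i) :
    (b i : ℝ) ≤ toReal (A i) ⬝ᵥ x := by
  classical
  have hmem : (A i, (b i : ℝ)) ∈ upPi A b := by
    have := mem_upPi_of_tight (A := A) (b := b) (lam := Pi.single i 1) (α := A i) (x := y)
      (fun k => by by_cases hk : k = i <;> simp [hk])
      (by simp [Pi.single_apply]) hy (fun k hk => by
        by_cases hk' : k = i
        · exact hk' ▸ hi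
        · simp [hk'] at hk)
    simpa [Pi.single_apply] using this
  have hm : 1 ≤ m := Nat.one_le_iff_ne_zero.2 fun h => (h ▸ i).elim0
  have hbM : b i ≤ m * constB b * constM m (constB b) D := by
    have h1 := le_constB b i
    rcases ((hb i).trans h1).eq_or_lt with h0 | h0
    · rw [← h0] at h1 ⊢
      simpa using h1
    · have h2 : 1 ≤ constM m (constB b) D := one_le_prod_constMi hm h0 hD _
      have h3 : (1 : ℤ) ≤ m := by exact_mod_cast hm
      calc b i ≤ constB b := h1
        _ ≤ m * constB b := le_mul_of_one_le_left h0.le h3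
        _ ≤ _ := le_mul_of_one_le_right (by positivity) h2
  have hbd : (A i, (b i : ℝ)) ∈
      upPiBounded r A b ((m * constB b * constM m (constB b) D : ℤ) : ℝ) := by
    refine ⟨hmem, fun j hj => ?_⟩
    have h1 : (1 : ℝ) ≤ ((A i ⬝ᵥ r j : ℤ) : ℝ) := by
      exact_mod_cast (show 0 < A i ⬝ᵥ r j from hj)
    exact (div_le_self (Int.cast_nonneg (hb i)) h1).trans (Int.cast_le.2 hbM)
  obtain ⟨c, hc, hcx⟩ := Set.mem_iInter₂.1 hx _ hbd
  exact hc.1.1.trans hcx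

/-- The cuts with bounded intercepts imply all cuts. -/
theorem closureOver_upPiBounded (hb : ∀ i, 0 ≤ b i) (hAr : ∀ i j, 0 ≤ A i ⬝ᵥ r j) (hD0 : 0 ≤ D)
    (hD : ∀ j, ∑ i, A i ⬝ᵥ r j ≤ D) (hray : ∀ j, ∀ z ∈ S, ∀ k : ℕ, z + (k : ℤ) • r j ∈ S)
    (hSA : ∀ z ∈ S, ∀ i, 0 ≤ A i ⬝ᵥ z)
    (hle : ∀ p ∈ upPi A b, ∃ z ∈ S, toReal p.1 ⬝ᵥ toReal z ≤ p.2)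
    (hge : ∀ p ∈ upPi A b, ∃ z ∈ S, p.2 ≤ toReal p.1 ⬝ᵥ toReal z) :
    upClosure S A b =
      closureOver S (upPiBounded r A b ((m * constB b * constM m (constB b) D : ℤ) : ℝ)) := by
  refine Set.Subset.antisymm (Set.biInter_subset_biInter_left fun p hp => hp.1) fun x hx => ?_
  -- Induction on an integer bound for the sum of the real multipliers, which each domination step
  -- lowers by at least one.
  have key : ∀ N : ℕ, ∀ (lam : Fin m → ℝ) (α : Fin n → ℤ), (∀ i, 0 ≤ lam i) →
      toReal α = ∑ i, lam i • toReal (A i) →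
      IsLeast ((fun x => toReal α ⬝ᵥ x) '' upPoly A b) (∑ i, lam i * (b i : ℝ)) →
      ∑ i, lam i ≤ N → x ∈ sCut S α (∑ i, lam i * (b i : ℝ)) := by
    intro N
    induction N with
    | zero => ?_
    | succ N ih => ?_
    all_goals
      intro lam α hlam hα hmin hN
      have hmem : (α, ∑ i, lam i * (b i : ℝ)) ∈ upPi A b := ⟨lam, hlam, hα, rfl, hmin⟩
      by_cases hbd : (α, ∑ i, lam i * (b i : ℝ)) ∈
          upPiBounded r A b ((m * constB b * constM m (constB b) D : ℤ) : ℝ)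
      · exact Set.mem_iInter₂.1 hx _ hbd
      obtain ⟨j, hj, hbig⟩ : ∃ j, 0 < α ⬝ᵥ r j ∧
          ((m * constB b * constM m (constB b) D : ℤ) : ℝ) <
            (∑ i, lam i * (b i : ℝ)) / ((α ⬝ᵥ r j : ℤ) : ℝ) := by
        by_contra! hne
        exact hbd ⟨hmem, fun j hj => hne j hj⟩
      obtain ⟨z₀, hz₀, hz₀β⟩ := hle _ hmem
      obtain ⟨μ, hμ0, ⟨i₀, hi₀⟩, hμlam, hdom⟩ := exists_dominating_cut hb (fun i => hAr i j) (hD j)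
        (hray j) hSA hlam hα hz₀ hz₀β hj hbig
      have hμ0R : ∀ i, (0 : ℝ) ≤ μ i := fun i => by exact_mod_cast hμ0 i
      have hμsum : (1 : ℝ) ≤ ∑ i, (μ i : ℝ) :=
        le_trans (by exact_mod_cast hi₀) (Finset.single_le_sum (f := fun i => (μ i : ℝ))
          (fun i _ => hμ0R i) (Finset.mem_univ i₀))
    -- With zero total multiplier there is no room for `μ`, so an unbounded intercept is impossible.
    · have := Finset.sum_le_sum fun i (_ : i ∈ Finset.univ) => hμlam i
      push_cast at hN
      linarith
    · obtain ⟨y, hy, htight⟩ := exists_tight_of_isLeast hlam hα hmin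
      have hα' : toReal (α - ∑ i, μ i • A i) = ∑ i, (lam i - μ i) • toReal (A i) := by
        rw [toReal_sub, toReal_sum, hα]
        simp only [toReal_smul, sub_smul, Finset.sum_sub_distrib]
      have hlamμ : ∀ i, (μ i : ℝ) ≠ 0 → lam i ≠ 0 := fun i hi h0 => by
        have h1 := hμlam i
        rw [h0] at h1
        exact hi (le_antisymm h1 (hμ0R i))
      have hmem' : (α - ∑ i, μ i • A i, ∑ i, (lam i - μ i) * (b i : ℝ)) ∈ upPi A b :=
        mem_upPi_of_tight (fun i => sub_nonneg.2 (hμlam i)) hα' hy fun i hi => by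
          refine htight i fun h0 => hi ?_
          by_contra h1
          exact hlamμ i (fun h2 => h1 (by rw [h0, h2, sub_zero])) h0
      obtain ⟨lam', -, -, -, hmin'⟩ := id hmem'
      obtain ⟨c', hc', hc'x⟩ := ih (fun i => lam i - μ i) _ (fun i => sub_nonneg.2 (hμlam i)) hα'
        hmin' (by
          rw [Finset.sum_sub_distrib]
          push_cast at hN
          linarith)
      obtain ⟨z₁, hz₁, hz₁β⟩ := hge _ hmem
      obtain ⟨c, hc⟩ := exists_isSCeil hz₁ hz₁β
      refine ⟨c, hc, (hdom c c' hc hc').trans ?_⟩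
      have h1 : ∑ i, (μ i : ℝ) * b i ≤ ∑ i, (μ i : ℝ) * (toReal (A i) ⬝ᵥ x) := by
        refine Finset.sum_le_sum fun i _ => ?_
        by_cases hi : (μ i : ℝ) = 0
        · rw [hi, zero_mul, zero_mul]
        · exact mul_le_mul_of_nonneg_left
            (row_le_of_mem_closureOver hb hD0 hx hy (htight i (hlamμ i hi))) (hμ0R i)
      have h2 : toReal (α - ∑ i, μ i • A i) ⬝ᵥ x =
          toReal α ⬝ᵥ x - ∑ i, (μ i : ℝ) * (toReal (A i) ⬝ᵥ x) := by
        rw [toReal_sub, toReal_sum, sub_dotProduct, sum_dotProduct]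
        simp only [toReal_smul, smul_dotProduct, smul_eq_mul]
      linarith
  refine Set.mem_iInter₂.2 fun p hp => ?_
  obtain ⟨lam, hlam, hα, hβ, hmin⟩ := hp
  rw [hβ] at hmin ⊢
  exact key ⌈∑ i, lam i⌉₊ lam p.1 hlam hα hmin (Nat.le_ceil _)

end BoundedIntercepts

/-! ### Sign cells of multipliers and polyhedrality. -/

/-- The integer linear forms on multiplier space whose signs determine, for a finite set `F` of
candidate points and intercept bound `K`, the point at which a cut is tight. -/
def signForms {m n h : ℕ} (r : Fin h → Fin n → ℤ) (A : Matrix (Fin m) (Fin n) ℤ)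
    (b : Fin m → ℤ) (K : ℤ) (F : Finset (Fin n → ℤ)) : Finset (Fin m → ℤ) :=
  Finset.univ.image (fun i => Pi.single i 1) ∪
    Finset.univ.image (fun j i => A i ⬝ᵥ r j) ∪
    Finset.univ.image (fun j i => K * (A i ⬝ᵥ r j) - b i) ∪
    F.image (fun z i => A i ⬝ᵥ z - b i) ∪
    (F ×ˢ F).image (fun z i => A i ⬝ᵥ z.1 - A i ⬝ᵥ z.2)

theorem pos_iff_pos_of_sign_eq {x y : ℝ} (h : SignType.sign x = SignType.sign y) :
    0 < x ↔ 0 < y := by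
  rw [← sign_eq_one_iff, h, sign_eq_one_iff]

theorem nonneg_iff_nonneg_of_sign_eq {x y : ℝ} (h : SignType.sign x = SignType.sign y) :
    0 ≤ x ↔ 0 ≤ y := by
  rw [← sign_nonneg_iff, h, sign_nonneg_iff]

section Cells

variable {m n h : ℕ} {S : Set (Fin n → ℤ)} {A : Matrix (Fin m) (Fin n) ℤ} {b : Fin m → ℤ}
  {r : Fin h → Fin n → ℤ} {K : ℤ}

theorem toReal_mulVec_dotProduct {lam : Fin m → ℝ} {α : Fin n → ℤ}
    (hα : toReal α = ∑ i, lam i • toReal (A i)) (z : Fin n → ℤ) :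
    toReal (fun i => A i ⬝ᵥ z) ⬝ᵥ lam = toReal α ⬝ᵥ toReal z := by
  rw [hα, sum_dotProduct]
  simp only [smul_dotProduct, toReal_dotProduct, smul_eq_mul]
  simp only [dotProduct, toReal]
  exact Finset.sum_congr rfl fun i _ => mul_comm _ _

theorem toReal_dotProduct_eq_sum (b : Fin m → ℤ) (lam : Fin m → ℝ) :
    toReal b ⬝ᵥ lam = ∑ i, lam i * (b i : ℝ) :=
  Finset.sum_congr rfl fun _ _ => mul_comm _ _

/-- Cuts with bounded intercepts are tight at points with bounded ray coordinates. -/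
theorem exists_mem_bounded_le {F₀ F : Finset (Fin n → ℤ)} (hF₀S : ∀ f ∈ F₀, f ∈ S)
    (hF₀ : ∀ z ∈ S, ∃ f ∈ F₀, ∃ k : Fin h → ℕ, z = f + ∑ j, (k j : ℤ) • r j)
    (hF : ∀ f ∈ F₀, ∀ k : Fin h → ℕ, (∀ j, k j ≤ K.toNat) → f + ∑ j, (k j : ℤ) • r j ∈ F)
    (hSA : ∀ z ∈ S, ∀ i, 0 ≤ A i ⬝ᵥ z) (hAr : ∀ i j, 0 ≤ A i ⬝ᵥ r j)
    {p : (Fin n → ℤ) × ℝ} (hp : p ∈ upPiBounded r A b K) {z : Fin n → ℤ} (hz : z ∈ S)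
    (hzβ : p.2 ≤ toReal p.1 ⬝ᵥ toReal z) :
    ∃ y ∈ F, p.2 ≤ toReal p.1 ⬝ᵥ toReal y ∧ toReal p.1 ⬝ᵥ toReal y ≤ toReal p.1 ⬝ᵥ toReal z := by
  obtain ⟨⟨lam, hlam, hα, -, -⟩, hbd⟩ := hp
  have hnn : ∀ y : Fin n → ℤ, (∀ i, 0 ≤ A i ⬝ᵥ y) → 0 ≤ p.1 ⬝ᵥ y := fun y hy => by
    have : 0 ≤ toReal p.1 ⬝ᵥ toReal y := by
      rw [hα, sum_dotProduct]
      refine Finset.sum_nonneg fun i _ => ?_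
      rw [smul_dotProduct, toReal_dotProduct]
      exact mul_nonneg (hlam i) (by exact_mod_cast hy i)
    rw [toReal_dotProduct] at this
    exact_mod_cast this
  have hr : ∀ j, 0 ≤ p.1 ⬝ᵥ r j := fun j => hnn (r j) (hAr · j)
  obtain ⟨f, hf, k, rfl⟩ := hF₀ z hz
  have hval : ∀ k : Fin h → ℕ, p.1 ⬝ᵥ (f + ∑ j, (k j : ℤ) • r j) =
      p.1 ⬝ᵥ f + ∑ j, (k j : ℤ) * (p.1 ⬝ᵥ r j) := fun k => by
    rw [dotProduct_add, dotProduct_sum]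
    simp only [dotProduct_smul, smul_eq_mul]
  set k' : Fin h → ℕ := fun j => min (k j) K.toNat with hk'
  set k'' : Fin h → ℕ := fun j => if p.1 ⬝ᵥ r j = 0 then 0 else k' j with hk''
  have hk''k' : ∀ j, (k'' j : ℤ) * (p.1 ⬝ᵥ r j) = (k' j : ℤ) * (p.1 ⬝ᵥ r j) := fun j => by
    by_cases h0 : p.1 ⬝ᵥ r j = 0
    · rw [h0, mul_zero, mul_zero]
    · simp only [hk'', if_neg h0]
  refine ⟨_, hF f hf k' fun j => min_le_right _ _, ?_, ?_⟩
  -- Capping coordinates with `α r^j = 0` changes nothing. If a coordinate with `α r^j > 0` is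
  -- really capped, that ray alone contributes at least `K α r^j ≥ β`, and the other terms are
  -- nonnegative.
  · by_cases hall : ∀ j, 0 < p.1 ⬝ᵥ r j → k j ≤ K.toNat
    · convert hzβ using 1
      rw [toReal_dotProduct, toReal_dotProduct, hval, hval]
      congr 2
      refine Finset.sum_congr rfl fun j _ => ?_
      rcases (hr j).eq_or_lt with h0 | h0
      · rw [← h0, mul_zero, mul_zero]
      · simp only [hk', min_eq_left (hall j h0)]
    · push Not at hall
      obtain ⟨j, hj, hkj⟩ := hall
      have hjR : (0 : ℝ) < ((p.1 ⬝ᵥ r j : ℤ) : ℝ) := by exact_mod_cast hj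
      have h1 := hbd j hj
      rw [div_le_iff₀ hjR] at h1
      refine h1.trans ?_
      rw [toReal_dotProduct, hval]
      have h2 : (K.toNat : ℤ) * (p.1 ⬝ᵥ r j) ≤ ∑ j, (k' j : ℤ) * (p.1 ⬝ᵥ r j) := by
        have : (K.toNat : ℤ) * (p.1 ⬝ᵥ r j) = (k' j : ℤ) * (p.1 ⬝ᵥ r j) := by
          simp only [hk', min_eq_right hkj.le]
        rw [this]
        exact Finset.single_le_sum (f := fun j => (k' j : ℤ) * (p.1 ⬝ᵥ r j))
          (fun i _ => mul_nonneg (Int.natCast_nonneg _) (hr i)) (Finset.mem_univ j)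
      have h3 : K * (p.1 ⬝ᵥ r j) ≤ (K.toNat : ℤ) * (p.1 ⬝ᵥ r j) :=
        mul_le_mul_of_nonneg_right (Int.self_le_toNat K) hj.le
      have h4 := hnn f (hSA f (hF₀S f hf))
      exact_mod_cast (by linarith : K * (p.1 ⬝ᵥ r j) ≤
        p.1 ⬝ᵥ f + ∑ j, (k' j : ℤ) * (p.1 ⬝ᵥ r j))
  · rw [toReal_dotProduct, toReal_dotProduct, hval, hval]
    have : ∑ j, (k' j : ℤ) * (p.1 ⬝ᵥ r j) ≤ ∑ j, (k j : ℤ) * (p.1 ⬝ᵥ r j) :=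
      Finset.sum_le_sum fun j _ => mul_le_mul_of_nonneg_right
        (by exact_mod_cast min_le_left _ _) (hr j)
    exact_mod_cast (by linarith : p.1 ⬝ᵥ f + ∑ j, (k' j : ℤ) * (p.1 ⬝ᵥ r j) ≤
        p.1 ⬝ᵥ f + ∑ j, (k j : ℤ) * (p.1 ⬝ᵥ r j))

variable {F : Finset (Fin n → ℤ)}

/-- Membership in `upPiBounded` and the point at which the cut is tight depend only on the signs of
the forms in `signForms`. -/
theorem isSCeil_of_sign_eq (hFS : ∀ f ∈ F, f ∈ S)
    (hF : ∀ p ∈ upPiBounded r A b K, ∀ z ∈ S, p.2 ≤ toReal p.1 ⬝ᵥ toReal z →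
      ∃ y ∈ F, p.2 ≤ toReal p.1 ⬝ᵥ toReal y ∧ toReal p.1 ⬝ᵥ toReal y ≤ toReal p.1 ⬝ᵥ toReal z)
    {lam lam' : Fin m → ℝ} {α α' : Fin n → ℤ} (hlam : ∀ i, 0 ≤ lam i)
    (hα : toReal α = ∑ i, lam i • toReal (A i)) (hα' : toReal α' = ∑ i, lam' i • toReal (A i))
    (hsign : ∀ a ∈ signForms r A b K F,
      SignType.sign (toReal a ⬝ᵥ lam') = SignType.sign (toReal a ⬝ᵥ lam))
    (hmem : (α, ∑ i, lam i * (b i : ℝ)) ∈ upPiBounded r A b K) {y : Fin n → ℤ} (hyF : y ∈ F)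
    (hy : IsSCeil S α (∑ i, lam i * (b i : ℝ)) (toReal α ⬝ᵥ toReal y)) :
    (α', ∑ i, lam' i * (b i : ℝ)) ∈ upPiBounded r A b K ∧
      IsSCeil S α' (∑ i, lam' i * (b i : ℝ)) (toReal α' ⬝ᵥ toReal y) := by
  classical
  have hsingle : ∀ i, SignType.sign (lam' i) = SignType.sign (lam i) := fun i => by
    have := hsign (Pi.single i 1) (by simp [signForms])
    have h1 : ∀ l : Fin m → ℝ, toReal (Pi.single i 1) ⬝ᵥ l = l i := fun l => by
      have : toReal (Pi.single i 1 : Fin m → ℤ) = Pi.single i 1 := by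
        ext k
        by_cases hk : k = i
        · subst hk; simp [toReal]
        · simp [toReal, hk]
      rw [this, single_dotProduct, one_mul]
    rwa [h1, h1] at this
  have hrsign : ∀ j, SignType.sign (toReal α' ⬝ᵥ toReal (r j)) =
      SignType.sign (toReal α ⬝ᵥ toReal (r j)) := fun j => by
    rw [← toReal_mulVec_dotProduct hα', ← toReal_mulVec_dotProduct hα]
    exact hsign _ (by simp [signForms])
  have hKsign : ∀ j, SignType.sign (K * (toReal α' ⬝ᵥ toReal (r j)) - ∑ i, lam' i * (b i : ℝ)) =
      SignType.sign (K * (toReal α ⬝ᵥ toReal (r j)) - ∑ i, lam i * (b i : ℝ)) := fun j => by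
    have h1 : toReal (fun i => K * (A i ⬝ᵥ r j) - b i) =
        (K : ℝ) • toReal (fun i => A i ⬝ᵥ r j) - toReal b := by ext; simp [toReal]
    have h2 := hsign (fun i => K * (A i ⬝ᵥ r j) - b i) (by simp [signForms])
    rwa [h1, sub_dotProduct, sub_dotProduct, smul_dotProduct, smul_dotProduct,
      toReal_mulVec_dotProduct hα', toReal_mulVec_dotProduct hα, toReal_dotProduct_eq_sum b lam',
      toReal_dotProduct_eq_sum b lam, smul_eq_mul, smul_eq_mul] at h2
  have hbsign : ∀ z ∈ F, SignType.sign (toReal α' ⬝ᵥ toReal z - ∑ i, lam' i * (b i : ℝ)) =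
      SignType.sign (toReal α ⬝ᵥ toReal z - ∑ i, lam i * (b i : ℝ)) := fun z hz => by
    have h1 : toReal (fun i => A i ⬝ᵥ z - b i) = toReal (fun i => A i ⬝ᵥ z) - toReal b := by
      ext; simp [toReal]
    have h2 := hsign (fun i => A i ⬝ᵥ z - b i) (by
      simp only [signForms, Finset.mem_union]
      exact Or.inl (Or.inr (Finset.mem_image.2 ⟨z, hz, rfl⟩)))
    rwa [h1, sub_dotProduct, sub_dotProduct, toReal_mulVec_dotProduct hα',
      toReal_mulVec_dotProduct hα, toReal_dotProduct_eq_sum b lam',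
      toReal_dotProduct_eq_sum b lam] at h2
  have hFsign : ∀ z ∈ F, ∀ w ∈ F, SignType.sign (toReal α' ⬝ᵥ toReal z - toReal α' ⬝ᵥ toReal w) =
      SignType.sign (toReal α ⬝ᵥ toReal z - toReal α ⬝ᵥ toReal w) := fun z hz w hw => by
    have h1 : toReal (fun i => A i ⬝ᵥ z - A i ⬝ᵥ w) =
        toReal (fun i => A i ⬝ᵥ z) - toReal (fun i => A i ⬝ᵥ w) := by ext; simp [toReal]
    have h2 := hsign (fun i => A i ⬝ᵥ z - A i ⬝ᵥ w) (by
      simp only [signForms, Finset.mem_union]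
      exact Or.inr (Finset.mem_image.2 ⟨(z, w), Finset.mem_product.2 ⟨hz, hw⟩, rfl⟩))
    rwa [h1, sub_dotProduct, sub_dotProduct, toReal_mulVec_dotProduct hα',
      toReal_mulVec_dotProduct hα, toReal_mulVec_dotProduct hα',
      toReal_mulVec_dotProduct hα] at h2
  obtain ⟨-, -, -, -, hmin⟩ := id hmem.1
  obtain ⟨x, hx, htight⟩ := exists_tight_of_isLeast hlam hα hmin
  have hmem' : (α', ∑ i, lam' i * (b i : ℝ)) ∈ upPiBounded r A b K := by
    refine ⟨mem_upPi_of_tight (fun i => (nonneg_iff_nonneg_of_sign_eq (hsingle i)).2 (hlam i))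
      hα' hx fun i hi => htight i fun h0 => hi ?_, fun j hj => ?_⟩
    · rw [← sign_eq_zero_iff, hsingle i, h0, sign_zero]
    · have hjR : (0 : ℝ) < ((α' ⬝ᵥ r j : ℤ) : ℝ) := by exact_mod_cast (show 0 < α' ⬝ᵥ r j from hj)
      have hjα : (0 : ℝ) < toReal α ⬝ᵥ toReal (r j) := by
        rwa [← pos_iff_pos_of_sign_eq (hrsign j), toReal_dotProduct]
      have h1 : (∑ i, lam i * (b i : ℝ)) / ((α ⬝ᵥ r j : ℤ) : ℝ) ≤ K := hmem.2 j (by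
        rw [toReal_dotProduct] at hjα
        exact (by exact_mod_cast hjα : 0 < α ⬝ᵥ r j))
      rw [← toReal_dotProduct, div_le_iff₀ hjα] at h1
      show (∑ i, lam' i * (b i : ℝ)) / ((α' ⬝ᵥ r j : ℤ) : ℝ) ≤ K
      rw [div_le_iff₀ hjR, ← toReal_dotProduct]
      exact sub_nonneg.1 ((nonneg_iff_nonneg_of_sign_eq (hKsign j)).2 (sub_nonneg.2 h1))
  refine ⟨hmem', ⟨sub_nonneg.1 ((nonneg_iff_nonneg_of_sign_eq (hbsign y hyF)).2
    (sub_nonneg.2 hy.1.1)), y, hFS y hyF, rfl⟩, ?_⟩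
  rintro _ ⟨hz, z, hzS, rfl⟩
  -- Every competitor is beaten by one in `F`, where the sign forms decide both feasibility and
  -- order.
  obtain ⟨w, hwF, hw1, hw2⟩ := hF _ hmem' z hzS hz
  refine le_trans ?_ hw2
  have h1 := sub_nonneg.1 ((nonneg_iff_nonneg_of_sign_eq (hbsign w hwF)).1 (sub_nonneg.2 hw1))
  have h2 := hy.2 ⟨h1, w, hFS w hwF, rfl⟩
  exact sub_nonneg.1 ((nonneg_iff_nonneg_of_sign_eq (hFsign w hwF y hyF)).2 (sub_nonneg.2 h2))

/-- The closure over cuts with bounded intercepts is a rational polyhedron. -/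
theorem isRationalPolyhedron_closureOver (hFS : ∀ f ∈ F, f ∈ S)
    (hF : ∀ p ∈ upPiBounded r A b K, ∀ z ∈ S, p.2 ≤ toReal p.1 ⬝ᵥ toReal z →
      ∃ y ∈ F, p.2 ≤ toReal p.1 ⬝ᵥ toReal y ∧ toReal p.1 ⬝ᵥ toReal y ≤ toReal p.1 ⬝ᵥ toReal z)
    (hge : ∀ p ∈ upPi A b, ∃ z ∈ S, p.2 ≤ toReal p.1 ⬝ᵥ toReal z) :
    IsRationalPolyhedron (closureOver S (upPiBounded r A b K)) := by
  classical
  set L := signForms r A b K F with hL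
  set V : Set (Fin m → ℝ) := {lam | (∀ i, 0 ≤ lam i) ∧ ∃ α : Fin n → ℤ,
    toReal α = ∑ i, lam i • toReal (A i) ∧ (α, ∑ i, lam i * (b i : ℝ)) ∈ upPiBounded r A b K}
    with hV
  set f : (Fin m → ℝ) → (L → SignType) := fun lam a => SignType.sign (toReal a.1 ⬝ᵥ lam) with hf
  have hfeq : ∀ lam lam', f lam' = f lam → ∀ a ∈ L,
      SignType.sign (toReal a ⬝ᵥ lam') = SignType.sign (toReal a ⬝ᵥ lam) :=
    fun lam lam' h a ha => congrFun h ⟨a, ha⟩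
  have hVceil : ∀ lam ∈ V, ∃ y ∈ F, ∀ (lam' : Fin m → ℝ) (α' : Fin n → ℤ),
      (∀ a ∈ L, SignType.sign (toReal a ⬝ᵥ lam') = SignType.sign (toReal a ⬝ᵥ lam)) →
      toReal α' = ∑ i, lam' i • toReal (A i) →
      (α', ∑ i, lam' i * (b i : ℝ)) ∈ upPiBounded r A b K ∧
        IsSCeil S α' (∑ i, lam' i * (b i : ℝ)) (toReal α' ⬝ᵥ toReal y) := by
    rintro lam ⟨hlam, α, hα, hmem⟩
    obtain ⟨z, hz, hzβ⟩ := hge _ hmem.1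
    obtain ⟨c, hc⟩ := exists_isSCeil hz hzβ
    obtain ⟨hβc, z', hz', hcz'⟩ := hc.1
    obtain ⟨y, hyF, hy1, hy2⟩ := hF _ hmem z' hz' (hβc.trans_eq hcz')
    have hcy : c = toReal α ⬝ᵥ toReal y :=
      le_antisymm (hc.2 ⟨hy1, y, hFS y hyF, rfl⟩) (hy2.trans_eq hcz'.symm)
    rw [hcy] at hc
    exact ⟨y, hyF, fun lam' α' hsign hα' =>
      isSCeil_of_sign_eq hFS hF hlam hα hα' hsign hmem hyF hc⟩
  have hex : ∀ σ : L → SignType, ∃ (G : Finset (Fin m → ℤ)) (y : Fin n → ℤ), σ ∈ f '' V →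
      (∀ x ∈ closureOver S (upPiBounded r A b K), ∀ g ∈ G,
        0 ≤ toReal (∑ i, g i • A i) ⬝ᵥ (x - toReal y)) ∧
      ∀ lam ∈ V, f lam = σ → lam ∈ PointedCone.hull ℝ (toReal '' (G : Set (Fin m → ℤ))) ∧
        ∀ α : Fin n → ℤ, toReal α = ∑ i, lam i • toReal (A i) →
          IsSCeil S α (∑ i, lam i * (b i : ℝ)) (toReal α ⬝ᵥ toReal y) := by
    intro σ
    by_cases hσ : σ ∈ f '' V
    · obtain ⟨lam, hlamV, rfl⟩ := hσ
      obtain ⟨y, -, hy⟩ := hVceil lam hlamV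
      obtain ⟨G, g₀, hG, hhull⟩ := exists_sign_generators L lam
      refine ⟨G, y, fun _ => ⟨fun x hx g hg => ?_, fun lam' _ hlam' =>
        ⟨hhull lam' (hfeq _ _ hlam'), fun α hα => (hy lam' α (hfeq _ _ hlam') hα).2⟩⟩⟩
      -- Each `N g + g₀` is an integer multiplier in the cell, so its cut is among the given ones
      -- and is tight at the same `y`. A negative value at `g` would violate these cuts for large
      -- `N`.
      have hN : ∀ N : ℕ, 0 ≤ (N : ℝ) * (toReal (∑ i, g i • A i) ⬝ᵥ (x - toReal y)) +
          toReal (∑ i, g₀ i • A i) ⬝ᵥ (x - toReal y) := by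
        intro N
        have hα : toReal ((N : ℤ) • ∑ i, g i • A i + ∑ i, g₀ i • A i) =
            ∑ i, toReal ((N : ℤ) • g + g₀) i • toReal (A i) := by
          simp only [toReal_add, toReal_smul, toReal_sum, Pi.add_apply, Pi.smul_apply, add_smul,
            Finset.sum_add_distrib, Finset.smul_sum, smul_smul, smul_eq_mul,
            toReal, Int.cast_add, Int.cast_mul]
        obtain ⟨hmem, hceil⟩ := hy (toReal ((N : ℤ) • g + g₀)) _ (hG g hg N) hα
        obtain ⟨c, hc, hcx⟩ := Set.mem_iInter₂.1 hx _ hmem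
        rw [hc.unique hceil, ← sub_nonneg, ← dotProduct_sub, toReal_add, toReal_smul,
          add_dotProduct, smul_dotProduct, smul_eq_mul, Int.cast_natCast] at hcx
        exact hcx
      by_contra! hneg
      obtain ⟨N, hN'⟩ := exists_nat_gt ((toReal (∑ i, g₀ i • A i) ⬝ᵥ (x - toReal y)) /
        -(toReal (∑ i, g i • A i) ⬝ᵥ (x - toReal y)))
      rw [div_lt_iff₀ (by linarith)] at hN'
      linarith [hN N]
    · exact ⟨∅, 0, fun h => absurd h hσ⟩
  choose G y hGy using hex
  have heq : closureOver S (upPiBounded r A b K) =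
      ⋂ σ ∈ f '' V, {x | ∀ q ∈ (G σ).image (fun g => (-∑ i, g i • A i,
        -((∑ i, g i • A i) ⬝ᵥ y σ))), toReal q.1 ⬝ᵥ x ≤ (q.2 : ℝ)} := by
    have hcut : ∀ (g : Fin m → ℤ) (z : Fin n → ℤ) (x : Fin n → ℝ),
        toReal (-∑ i, g i • A i) ⬝ᵥ x ≤ ((-((∑ i, g i • A i) ⬝ᵥ z) : ℤ) : ℝ) ↔
          0 ≤ toReal (∑ i, g i • A i) ⬝ᵥ (x - toReal z) := fun g z x => by
      rw [toReal_neg, neg_dotProduct, Int.cast_neg, ← toReal_dotProduct, neg_le_neg_iff,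
        dotProduct_sub, sub_nonneg]
    refine Set.Subset.antisymm (fun x hx => ?_) fun x hx => ?_
    · refine Set.mem_iInter₂.2 fun σ hσ q hq => ?_
      obtain ⟨g, hg, rfl⟩ := Finset.mem_image.1 hq
      exact (hcut _ _ _).2 ((hGy σ hσ).1 x hx g hg)
    · refine Set.mem_iInter₂.2 fun p hp => ?_
      obtain ⟨lam, hlam, hα, hβ, -⟩ := id hp.1
      have hV : lam ∈ V := ⟨hlam, p.1, hα, by rw [← hβ]; exact hp⟩
      have hσ : f lam ∈ f '' V := ⟨lam, hV, rfl⟩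
      obtain ⟨hhull, hceil⟩ := (hGy _ hσ).2 lam hV rfl
      refine ⟨_, by rw [hβ]; exact hceil p.1 hα, ?_⟩
      rw [← sub_nonneg, ← dotProduct_sub]
      obtain ⟨c, hc, hlamc⟩ := (mem_hull_toReal_image _ _).1 hhull
      have hαc : ∀ G' : Finset (Fin m → ℤ), lam = ∑ g ∈ G', c g • toReal g →
          toReal p.1 = ∑ g ∈ G', c g • toReal (∑ i, g i • A i) := fun G' h => by
        rw [hα, h]
        simp only [Finset.sum_apply, Finset.sum_smul, toReal_sum, toReal_smul, Finset.smul_sum]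
        rw [Finset.sum_comm]
        refine Finset.sum_congr rfl fun g _ => Finset.sum_congr rfl fun i _ => ?_
        rw [Pi.smul_apply, smul_assoc]; rfl
      -- As `y` is common to the cell, the cut is linear in `lam` and is a nonnegative combination
      -- of the generator inequalities.
      rw [hαc _ hlamc, sum_dotProduct]
      refine Finset.sum_nonneg fun g hg => ?_
      rw [smul_dotProduct]
      exact mul_nonneg (hc g) ((hcut _ _ _).1
        (Set.mem_iInter₂.1 hx _ hσ _ (Finset.mem_image_of_mem _ hg)))
  rw [heq]
  exact IsRationalPolyhedron.biInter (Set.toFinite _) fun σ _ => isRationalPolyhedron_setOf _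

end Cells

end SCG

/-! ### The main theorem. -/

theorem mainTheorem4 {n₁ n₂ g h m : ℕ}
    -- `S` is the set of integer points of a pointed polyhedron `conv(S) = conv{v} + cone{r}`
    (S : Set (Fin (n₁ + n₂) → ℤ)) (hS : S.Nonempty)
    (hSint : ∀ z : Fin (n₁ + n₂) → ℤ, SCG.toReal z ∈ SCG.conv S → z ∈ S)
    (hSpt : SCG.IsPointed (SCG.conv S))
    (v : Fin g → Fin (n₁ + n₂) → ℤ) (r : Fin h → Fin (n₁ + n₂) → ℤ)
    (hSgen : SCG.conv S = SCG.conv (Set.range v) + SCG.cone r)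
    -- `cone{r} ⊆ {0} × ℝ^{n₂}` has dimension `n₂`, and `conv(S) ⊆ 𝒞`
    (hdim : Module.finrank ℝ (Submodule.span ℝ (SCG.cone r)) = n₂)
    (hr0 : ∀ x ∈ SCG.cone r, ∀ k : Fin n₁, x (Fin.castAdd n₂ k) = 0)
    (hSC : SCG.conv S ⊆ SCG.bigCone r)
    -- `A` is nonnegative on the generators of `𝒞`, and `b ≥ 0`
    (A : Matrix (Fin m) (Fin (n₁ + n₂)) ℤ) (b : Fin m → ℤ)
    (hAe : ∀ i k, 0 ≤ A i ⬝ᵥ SCG.unitVec n₁ n₂ k)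
    (hAr : ∀ i j, 0 ≤ A i ⬝ᵥ r j)
    (hb : ∀ i, 0 ≤ b i)
    (hP : (SCG.upPoly A b).Nonempty)
    (hPC : SCG.upPoly A b ⊆ SCG.bigCone r)
    (hPext : (SCG.upPoly A b).extremePoints ℝ ⊆ SCG.conv S) :
    SCG.upClosure S A b =
        SCG.closureOver S (SCG.upPiBounded r A b ((SCG.constMstar r A b : ℤ) : ℝ)) ∧
      SCG.IsRationalPolyhedron (SCG.upClosure S A b) := by
  classical
  have hSA : ∀ z ∈ S, ∀ i, 0 ≤ A i ⬝ᵥ z := fun z hz i => by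
    have := SCG.dotProduct_nonneg_of_mem_bigCone (hAe i) (hAr i)
      (hSC (subset_convexHull ℝ _ ⟨z, hz, rfl⟩))
    rw [SCG.toReal_dotProduct] at this
    exact_mod_cast this
  have hrays : ∀ z ∈ S, ∀ k : Fin h → ℕ, z + ∑ j, (k j : ℤ) • r j ∈ S := fun z hz k =>
    SCG.add_rays_mem hSint hSgen hz k
  have hray : ∀ j, ∀ z ∈ S, ∀ k : ℕ, z + (k : ℤ) • r j ∈ S := fun j z hz k => by
    convert hrays z hz (Pi.single j k) using 2
    rw [Finset.sum_eq_single j] <;> simp +contextual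
  have hopt : ∀ p ∈ SCG.upPi A b, ∃ x ∈ SCG.conv S, SCG.toReal p.1 ⬝ᵥ x = p.2 := by
    rintro p ⟨-, -, -, -, hmin⟩
    obtain ⟨x, hx, hxp⟩ := SCG.exists_extreme_minimizer hb
      (fun x hx => SCG.eq_zero_of_forall_dotProduct_eq_zero hS hSpt hSgen hr0 hP hPC hx) hmin
    exact ⟨x, hPext hx, hxp⟩
  have hle : ∀ p ∈ SCG.upPi A b, ∃ z ∈ S, SCG.toReal p.1 ⬝ᵥ SCG.toReal z ≤ p.2 := fun p hp => by
    obtain ⟨x, hx, hxp⟩ := hopt p hp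
    exact hxp ▸ SCG.exists_le_of_mem_conv hx
  have hge : ∀ p ∈ SCG.upPi A b, ∃ z ∈ S, p.2 ≤ SCG.toReal p.1 ⬝ᵥ SCG.toReal z := fun p hp => by
    obtain ⟨x, hx, hxp⟩ := hopt p hp
    exact hxp ▸ SCG.exists_ge_of_mem_conv hx
  have hD0 : 0 ≤ SCG.constD r A := Finset.sum_nonneg fun i _ => by
    rw [dotProduct_add, dotProduct_sum, dotProduct_sum]
    exact add_nonneg (Finset.sum_nonneg fun k _ => hAe i k) (Finset.sum_nonneg fun j _ => hAr i j)
  have hmain : SCG.upClosure S A b =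
      SCG.closureOver S (SCG.upPiBounded r A b ((SCG.constMstar r A b : ℤ) : ℝ)) :=
    SCG.closureOver_upPiBounded hb hAr hD0 (SCG.sum_dotProduct_le_constD hAe hAr) hray hSA hle hge
  refine ⟨hmain, ?_⟩
  rw [hmain]
  obtain ⟨F₀, hF₀S, hF₀⟩ := SCG.exists_finite_base hSint hSgen
  set K := SCG.constMstar r A b
  -- The base points translated by ray combinations with all coefficients at most `M*`. The `+ 1`
  -- makes the bound inclusive.
  set F := (F₀ ×ˢ Fintype.piFinset fun _ : Fin h => Finset.range (K.toNat + 1)).image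
    fun q => q.1 + ∑ j, (q.2 j : ℤ) • r j with hF
  refine SCG.isRationalPolyhedron_closureOver (F := F) (fun f hf => ?_) (fun p hp z hz hzβ =>
    SCG.exists_mem_bounded_le hF₀S hF₀ (fun f hf k hk => ?_) hSA hAr hp hz hzβ) hge
  · obtain ⟨q, hq, rfl⟩ := Finset.mem_image.1 hf
    exact hrays _ (hF₀S _ (Finset.mem_product.1 hq).1) _
  · exact Finset.mem_image.2 ⟨(f, k), Finset.mem_product.2 ⟨hf, Fintype.mem_piFinset.2 fun j =>
      Finset.mem_range.2 (Nat.lt_succ_of_le (hk j))⟩, rfl⟩
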